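/- Let $n\ge 1$, $m>0$, $j\in\{1,\dots,n\}$. For $\mathbf p\in\mathbb R^n$ with components $p^1,\dots,p^n$ put $p_j=-p^j$ (signature $(+,-,\dots,-)$), $p_kx^k=\sum_{k=1}^n p_kx^k=-\mathbf p\cdot\mathbf x$, $\omega_{\mathbf p}=\sqrt{|\mathbf p|^2+m^2}$ and $d\mu(\mathbf p)=d^n\mathbf p/(2\omega_{\mathbf p})$. On the bosonic Fock space over $L^2(\mathbb R^n,d\mu)$ let $\mathscr D$ be the space of finite-particle vectors $\Psi=(\Psi_k)_k$ whose components are symmetric Schwartz functions of $k$ momenta. Let $(a_c(\mathbf p)\Psi)_k(\mathbf p_1,\dots,\mathbf p_k)=\sqrt{k+1}\,\Psi_{k+1}(\mathbf p,\mathbf p_1,\dots,\mathbf p_k)$, $a(\mathbf p)=a_c(\mathbf p)/\sqrt{2\omega_{\mathbf p}}$, let $a^*(\mathbf p)$ be the corresponding creation operators (operator-valued distributions with $[a(\mathbf p),a^*(\mathbf q)]=\delta^n(\mathbf p-\mathbf q)$), and let $$\tilde a(\mathbf x)=(2\pi)^{-n/2}\int d^n\mathbf p\,e^{-ip_kx^k}a(\mathbf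 p),\qquad \tilde a^*(\mathbf x)=(2\pi)^{-n/2}\int d^n\mathbf p\,e^{ip_kx^k}a^*(\mathbf p)$$ be the ladder operators of the coordinate space. Consider on $\mathscr D$ $$P_0=\int d^n\mathbf p\,\omega_{\mathbf p}\,a^*(\mathbf p)a(\mathbf p),\qquad X_j=-i\int d^n\mathbf p\,a^*(\mathbf p)\frac{\partial}{\partial p^j}a(\mathbf p),\qquad V_j=\int d^n\mathbf p\,\frac{p_j}{\omega_{\mathbf p}}\,a^*(\mathbf p)a(\mathbf p).$$ Then the velocity operator $V_j$ is, in terms of the ladder operators of the coordinate space, $$V_j=-i\int d^n\mathbf x\,\tilde a^*(\mathbf x)\,(\tilde\omega_j\ast\tilde a)(\mathbf x),\qquad \tilde\omega_j(\mathbf x)=2(2\pi)^{-\frac{n+1}{2}}\Big(\frac{m}{|\mathbf x|}\Big)^{\frac{n+1}{2}}K_{\frac{n+1}{2}}(m|\mathbf x|)\,x^j,$$ where $x^j$ is the $j$-th Cartesian component of $\mathbf x$, $K_\nu$ is the modified Bessel function of the second kind, and the convolution is the principal value $$(\tilde\omega_j\ast\tilde a)(\mathbf x)=\lim_{\varepsilon\downarrow0}\int_{|\mathbf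 x-\mathbf y|>\varepsilon}d^n\mathbf y\,\tilde\omega_j(\mathbf x-\mathbf y)\,\tilde a(\mathbf y).$$ In detail: on every $\Psi\in\mathscr D$, componentwise and pointwise, the truncated integrals converge absolutely, the limit exists for every $\mathbf x$ and is integrable in $\mathbf x$. The identity holds as an identity of operators applied to $\Psi\in\mathscr D$. It also holds in the sense of forms: for all $\Phi,\Psi\in\mathscr D$, with absolutely convergent integrals over $\mathbf p$ and $\mathbf x$, $$\langle\Phi,V_j\Psi\rangle=\int d^n\mathbf p\,\frac{p_j}{\omega_{\mathbf p}}\langle a(\mathbf p)\Phi,a(\mathbf p)\Psi\rangle=-i\int d^n\mathbf x\,\langle\tilde a(\mathbf x)\Phi,(\tilde\omega_j\ast\tilde a)(\mathbf x)\Psi\rangle.$$ Moreover $V_j$ satisfies the Heisenberg equation $[P_0,X_j]=-iV_j$ on $\mathscr D$. -/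

import Mathlib

open MeasureTheory Filter Topology
open scoped SchwartzMap ComplexConjugate

noncomputable section

/-- Momentum space and coordinate space `ℝⁿ`; `x j` is the contravariant (Cartesian) component
`x^j`. -/
abbrev Vec (n : ℕ) : Type := EuclideanSpace ℝ (Fin n)

/-- The covariant component `p_j = -p^j` of a spatial vector, for the signature `(+,-,…,-)`. -/
def lowerIdx {n : ℕ} (p : Vec n) (j : Fin n) : ℝ := -(p j)

/-- The contraction `p_k x^k`, summed over the spatial indices. -/
def contr {n : ℕ} (p x : Vec n) : ℝ := ∑ k, lowerIdx p k * x k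

/-- The energy `ω_p = √(|p|² + m²)`. -/
def energy {n : ℕ} (m : ℝ) (p : Vec n) : ℝ := Real.sqrt (‖p‖ ^ 2 + m ^ 2)

/-- The modified Bessel function of the second kind,
`K_ν(z) = ∫₀^∞ exp(-z cosh t) cosh(ν t) dt`, for `z > 0`. -/
def besselK (ν z : ℝ) : ℝ :=
  ∫ t in Set.Ioi (0 : ℝ), Real.exp (-z * Real.cosh t) * Real.cosh (ν * t)

/-- Sequences `(Ψ_k)_k` of `k`-particle wave functions of the momenta, in the covariant
normalization. -/
abbrev WaveSeq (n : ℕ) : Type := (k : ℕ) → (Fin k → Vec n) → ℂ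

/-- Finite-particle vectors of the bosonic Fock space with symmetric Schwartz wave functions. -/
structure IsSchwartzFock {n : ℕ} (Ψ : WaveSeq n) : Prop where
  schwartz : ∀ k, ∃ f : 𝓢(Fin k → Vec n, ℂ), ∀ q, Ψ k q = f q
  symmetric : ∀ k (σ : Equiv.Perm (Fin k)) (q : Fin k → Vec n), Ψ k (q ∘ σ) = Ψ k q
  finite : ∃ N, ∀ k, N < k → Ψ k = 0

/-- The scalar product of Fock space,
`∑_k ∫ dμ(p₁) ⋯ ∫ dμ(p_k) conj(Φ_k) Ψ_k` with `dμ(p) = dp / (2 ω_p)`. -/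
def fockInner {n : ℕ} (m : ℝ) (Φ Ψ : WaveSeq n) : ℂ :=
  ∑' k, ∫ q : Fin k → Vec n,
    ((∏ i, (2 * energy m (q i))⁻¹ : ℝ) : ℂ) * (conj (Φ k q) * Ψ k q)

/-- The covariant annihilation operator with sharp momentum,
`(a_c(p)Ψ)_k(p₁,…,p_k) = √(k+1) Ψ_{k+1}(p,p₁,…,p_k)`. -/
def annCov {n : ℕ} (p : Vec n) (Ψ : WaveSeq n) : WaveSeq n :=
  fun k q => (Real.sqrt (k + 1) : ℂ) * Ψ (k + 1) (Fin.cons p q)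

/-- The smeared covariant creation operator `a_c(f)* = ∫ dμ(p) f(p) a_c*(p)`. -/
def creCov {n : ℕ} (f : Vec n → ℂ) (Ψ : WaveSeq n) : WaveSeq n
  | 0, _ => 0
  | k + 1, q => ((Real.sqrt (k + 1))⁻¹ : ℂ) *
      ∑ i : Fin (k + 1), f (q i) * Ψ k (q ∘ i.succAbove)

/-- The non-covariant annihilation operator `a(p) = a_c(p) / √(2ω_p)`. -/
def ann {n : ℕ} (m : ℝ) (p : Vec n) (Ψ : WaveSeq n) : WaveSeq n :=
  ((Real.sqrt (2 * energy m p))⁻¹ : ℂ) • annCov p Ψ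

/-- The vector `∫ dp a*(p) F(p)`, where `a*(p) = a_c*(p) / √(2ω_p)`, for a family `F` of Fock space
vectors: the linear extension of `a_c(f)*Ψ = ∫ dμ(p) a_c*(p) f(p)Ψ` from `f(p)Ψ` to general
families (see `creInt_smul`). -/
def creInt {n : ℕ} (m : ℝ) (F : Vec n → WaveSeq n) : WaveSeq n
  | 0, _ => 0
  | k + 1, q => ((Real.sqrt (k + 1))⁻¹ : ℂ) *
      ∑ i : Fin (k + 1),
        (Real.sqrt (2 * energy m (q i)) : ℂ) * F (q i) k (q ∘ i.succAbove)

theorem energy_pos {n : ℕ} {m : ℝ} (hm : 0 < m) (p : Vec n) : 0 < energy m p :=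
  Real.sqrt_pos.2 (by positivity)

/-- `∫ dp a*(p) (2ω_p)^{-1/2} f(p) Ψ = ∫ dμ(p) f(p) a_c*(p) Ψ = a_c(f)*Ψ`. -/
theorem creInt_smul {n : ℕ} {m : ℝ} (hm : 0 < m) (f : Vec n → ℂ) (Ψ : WaveSeq n) :
    creInt m (fun p => (f p / (Real.sqrt (2 * energy m p) : ℂ)) • Ψ) = creCov f Ψ := by
  funext k q
  cases k with
  | zero => rfl
  | succ k =>
    simp only [creInt, creCov, Pi.smul_apply, smul_eq_mul]
    congr 1
    refine Finset.sum_congr rfl fun i _ => ?_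
    have h : (Real.sqrt (2 * energy m (q i)) : ℂ) ≠ 0 := by
      have := energy_pos hm (q i)
      exact_mod_cast (Real.sqrt_pos.2 (by positivity)).ne'
    field_simp

/-- The energy operator `P_0 = ∫ dp ω_p a*(p) a(p)`. -/
def opP0 {n : ℕ} (m : ℝ) (Ψ : WaveSeq n) : WaveSeq n :=
  creInt m fun p => (energy m p : ℂ) • ann m p Ψ

/-- The Newton-Wigner-Pryce operator `X_j = -i ∫ dp a*(p) (∂/∂p^j) a(p)`. -/
def opX {n : ℕ} (m : ℝ) (j : Fin n) (Ψ : WaveSeq n) : WaveSeq n :=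
  (-Complex.I) • creInt m fun p k q =>
    fderiv ℝ (fun p' : Vec n => ann m p' Ψ k q) p (EuclideanSpace.single j (1 : ℝ))

/-- The velocity operator `V_j = ∫ dp (p_j / ω_p) a*(p) a(p)`. -/
def opV {n : ℕ} (m : ℝ) (j : Fin n) (Ψ : WaveSeq n) : WaveSeq n :=
  creInt m fun p => ((lowerIdx p j / energy m p : ℝ) : ℂ) • ann m p Ψ

/-- The annihilation operator of coordinate space,
`ã(x) = (2π)^{-n/2} ∫ dp e^{-i p_k x^k} a(p)`. -/
def annX {n : ℕ} (m : ℝ) (x : Vec n) (Ψ : WaveSeq n) : WaveSeq n :=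
  fun k q => (((2 * Real.pi) ^ (-(n : ℝ) / 2) : ℝ) : ℂ) *
    ∫ p : Vec n, Complex.exp (-(Complex.I * (contr p x : ℂ))) * ann m p Ψ k q

/-- The vector `∫ dx ã*(x) G(x)` for a family `G` of Fock space vectors, with
`ã*(x) = (2π)^{-n/2} ∫ dp e^{i p_k x^k} a*(p)`. -/
def creIntX {n : ℕ} (m : ℝ) (G : Vec n → WaveSeq n) : WaveSeq n :=
  creInt m fun p k q => (((2 * Real.pi) ^ (-(n : ℝ) / 2) : ℝ) : ℂ) *
    ∫ x : Vec n, Complex.exp (Complex.I * (contr p x : ℂ)) * G x k q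

/-- The kernel `ω̃_j(x) = 2 (2π)^{-(n+1)/2} (m/|x|)^{(n+1)/2} K_{(n+1)/2}(m|x|) x^j`. -/
def velKernel {n : ℕ} (m : ℝ) (j : Fin n) (x : Vec n) : ℝ :=
  2 * (2 * Real.pi) ^ (-((n : ℝ) + 1) / 2) * (m / ‖x‖) ^ (((n : ℝ) + 1) / 2) *
    besselK (((n : ℝ) + 1) / 2) (m * ‖x‖) * x j

/-- The integrand `y ↦ ω̃_j(x-y) ã(y)Ψ` of the convolution, in a component. -/
def velConvIntegrand {n : ℕ} (m : ℝ) (j : Fin n) (Ψ : WaveSeq n) (x : Vec n)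
    (k : ℕ) (q : Fin k → Vec n) (y : Vec n) : ℂ :=
  (velKernel m j (x - y) : ℂ) * annX m y Ψ k q

/-- The convolution integral with the ball of radius `ε` about the singularity `y = x` removed. -/
def velConvTrunc {n : ℕ} (m : ℝ) (j : Fin n) (ε : ℝ) (x : Vec n) (Ψ : WaveSeq n) : WaveSeq n :=
  fun k q => ∫ y in {y : Vec n | ε < ‖x - y‖}, velConvIntegrand m j Ψ x k q y

/-- The convolution `(ω̃_j ∗ ã)(x)Ψ`, a principal value because `|ω̃_j|` behaves as `|x|^{-n}`
at the origin. -/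
def velConv {n : ℕ} (m : ℝ) (j : Fin n) (x : Vec n) (Ψ : WaveSeq n) : WaveSeq n :=
  fun k q => limUnder (𝓝[>] (0 : ℝ)) fun ε => velConvTrunc m j ε x Ψ k q

end

/-!
Subordination, `1 / ω = π^{-1/2} ∫ s^{-1/2} exp(-s ω²) ds`, writes the Bessel kernel `ω̃_j` as `z_j`
times a positive mixture of heat kernels, and differentiating the Gaussian Fourier integral under
the mixture gives `∫ ω̃_j(z) sin(p · z) dz = p^j / ω_p`. The kernel is odd, so in the convolution
with a plane wave the cosine part drops out over every truncation domain `|z| > ε`, while the sine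
part is absolutely convergent because `|z| ω̃_j(z)` is integrable: the principal value exists and
acts on momentum space as the multiplication by `i p_j / ω_p`. The operator identity is then
Fourier inversion in one momentum variable, and the form identity is Plancherel's theorem in that
variable together with the exchange of the remaining integrals. In the Heisenberg equation only the
term `∂ω_p / ∂p^j` of the Leibniz rule survives.
-/

open scoped FourierTransform Real RealInnerProductSpace

section Bessel

theorem besselK_neg (ν z : ℝ) : besselK (-ν) z = besselK ν z := by
  simp only [besselK, neg_mul, Real.cosh_neg]

theorem one_add_sq_div_four_le_cosh (u : ℝ) : 1 + u ^ 2 / 4 ≤ Real.cosh u := by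
  have h1 := Real.quadratic_le_exp_of_nonneg (abs_nonneg u)
  have h2 := Real.add_one_le_exp (-|u|)
  rw [sq_abs] at h1
  rw [← Real.cosh_abs, Real.cosh_eq]
  linarith

theorem integrable_exp_mul_exp_neg_mul_cosh (ν : ℝ) {z : ℝ} (hz : 0 < z) :
    Integrable fun u : ℝ => Real.exp (ν * u) * Real.exp (-z * Real.cosh u) := by
  have hgauss : Integrable fun u : ℝ => Real.exp (-(z / 4) * u ^ 2 + ν * u + 0) := by
    have hb : (-((z / 4 : ℝ) : ℂ)).re < 0 := by
      rw [Complex.neg_re, Complex.ofReal_re]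
      linarith
    refine (integrable_cexp_quadratic' hb (ν : ℂ) 0).norm.congr (ae_of_all _ fun u => ?_)
    simp only [Complex.norm_exp]
    norm_cast
  refine hgauss.mono' (by fun_prop) (ae_of_all _ fun u => ?_)
  rw [Real.norm_of_nonneg (by positivity), ← Real.exp_add, Real.exp_le_exp]
  nlinarith [mul_le_mul_of_nonneg_left (one_add_sq_div_four_le_cosh u) hz.le]

theorem integral_exp_mul_exp_neg_mul_cosh (ν : ℝ) {z : ℝ} (hz : 0 < z) :
    ∫ u : ℝ, Real.exp (ν * u) * Real.exp (-z * Real.cosh u) = 2 * besselK ν z := by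
  have hreflect : ∫ u : ℝ, Real.exp (-ν * u) * Real.exp (-z * Real.cosh u)
      = ∫ u : ℝ, Real.exp (ν * u) * Real.exp (-z * Real.cosh u) := by
    rw [← integral_neg_eq_self]
    simp
  have heven : ∀ u : ℝ, Real.exp (-z * Real.cosh |u|) * Real.cosh (ν * |u|)
      = (Real.exp (ν * u) * Real.exp (-z * Real.cosh u)
        + Real.exp (-ν * u) * Real.exp (-z * Real.cosh u)) / 2 := by
    intro u
    rw [Real.cosh_abs, ← Real.cosh_abs (ν * |u|), abs_mul, abs_abs, ← abs_mul, Real.cosh_abs,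
      Real.cosh_eq (ν * u)]
    ring_nf
  have hfold := integral_comp_abs
    (f := fun u : ℝ => Real.exp (-z * Real.cosh u) * Real.cosh (ν * u))
  simp only [heven] at hfold
  rw [integral_div, integral_add (integrable_exp_mul_exp_neg_mul_cosh ν hz)
    (integrable_exp_mul_exp_neg_mul_cosh (-ν) hz), hreflect] at hfold
  rw [besselK, ← hfold]
  ring

theorem integral_Ioi_eq_integral_mul_exp {a : ℝ} (ha : 0 < a) (f : ℝ → ℝ) :
    ∫ s in Set.Ioi (0 : ℝ), f s = ∫ u : ℝ, a * Real.exp u * f (a * Real.exp u) := by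
  have himage : (fun u : ℝ => a * Real.exp u) '' Set.univ = Set.Ioi 0 := by
    ext s
    simp only [Set.image_univ, Set.mem_range, Set.mem_Ioi]
    constructor
    · rintro ⟨u, rfl⟩
      positivity
    · intro hs
      exact ⟨Real.log (s / a), by rw [Real.exp_log (by positivity)]; field_simp⟩
  rw [← himage, integral_image_eq_integral_deriv_smul_of_monotoneOn MeasurableSet.univ
    (f' := fun u => a * Real.exp u)
    (fun u _ => ((Real.hasDerivAt_exp u).const_mul a).hasDerivWithinAt)
    (fun u _ v _ huv => by gcongr), Measure.restrict_univ]
  simp only [smul_eq_mul]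

theorem integral_rpow_mul_exp_neg_add_div (ν : ℝ) {m r : ℝ} (hm : 0 < m) (hr : 0 < r) :
    ∫ s in Set.Ioi (0 : ℝ), s ^ (-(ν + 1)) * Real.exp (-(s * m ^ 2) - r ^ 2 / (4 * s))
      = 2 * (2 * m / r) ^ ν * besselK ν (m * r) := by
  have ha : 0 < r / (2 * m) := by positivity
  -- The substitution `s = r e^u / (2m)` turns the exponent into `-m r cosh u`.
  have hsubst : ∀ u : ℝ, r / (2 * m) * Real.exp u * ((r / (2 * m) * Real.exp u) ^ (-(ν + 1)) *
      Real.exp (-(r / (2 * m) * Real.exp u * m ^ 2) - r ^ 2 / (4 * (r / (2 * m) * Real.exp u))))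
      = (2 * m / r) ^ ν * (Real.exp (-ν * u) * Real.exp (-(m * r) * Real.cosh u)) := by
    intro u
    have hpos : 0 < r / (2 * m) * Real.exp u := by positivity
    have hpow : r / (2 * m) * Real.exp u * (r / (2 * m) * Real.exp u) ^ (-(ν + 1))
        = (2 * m / r) ^ ν * Real.exp (-ν * u) := by
      nth_rewrite 1 [← Real.rpow_one (r / (2 * m) * Real.exp u)]
      rw [← Real.rpow_add hpos, show 1 + -(ν + 1) = -ν by ring,
        Real.mul_rpow ha.le (Real.exp_pos u).le, ← Real.exp_mul, mul_comm u, Real.rpow_neg ha.le,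
        ← Real.inv_rpow ha.le, inv_div]
    have hexp : -(r / (2 * m) * Real.exp u * m ^ 2) - r ^ 2 / (4 * (r / (2 * m) * Real.exp u))
        = -(m * r) * Real.cosh u := by
      rw [Real.cosh_eq, Real.exp_neg]
      field_simp
      ring
    rw [← mul_assoc, hpow, hexp, mul_assoc]
  rw [integral_Ioi_eq_integral_mul_exp ha, integral_congr_ae (ae_of_all _ hsubst),
    integral_const_mul, integral_exp_mul_exp_neg_mul_cosh (-ν) (by positivity), besselK_neg]
  ring

end Bessel

section HeatKernel

variable {V : Type*} [NormedAddCommGroup V] [InnerProductSpace ℝ V]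

/-- The heat kernel `(4πs)^{-d/2} exp(-|z|² / 4s)` of a `d`-dimensional Euclidean space, the
Gaussian with Fourier transform `exp(-s |p|²)`. -/
noncomputable def heatKernel (s : ℝ) (z : V) : ℝ :=
  (4 * π * s) ^ (-(Module.finrank ℝ V : ℝ) / 2) * Real.exp (-(4 * s)⁻¹ * ‖z‖ ^ 2)

theorem heatKernel_nonneg {s : ℝ} (hs : 0 ≤ s) (z : V) : 0 ≤ heatKernel s z := by
  unfold heatKernel
  positivity

theorem fderiv_heatKernel (s : ℝ) (z v : V) :
    fderiv ℝ (heatKernel s) z v = -(2 * s)⁻¹ * (⟪v, z⟫ * heatKernel s z) := by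
  have h : HasFDerivAt (heatKernel s)
      (((4 * π * s) ^ (-(Module.finrank ℝ V : ℝ) / 2)) •
        Real.exp (-(4 * s)⁻¹ * ‖z‖ ^ 2) • -(4 * s)⁻¹ • 2 • innerSL ℝ z) z :=
    (((hasStrictFDerivAt_norm_sq z).hasFDerivAt.const_mul _).exp).const_mul _
  rw [h.fderiv, heatKernel, real_inner_comm z v]
  simp only [smul_apply, innerSL_apply_apply, smul_eq_mul, mul_inv, nsmul_eq_mul]
  push_cast
  ring

theorem differentiable_heatKernel (s : ℝ) : Differentiable ℝ (heatKernel (V := V) s) := fun z =>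
  (((hasStrictFDerivAt_norm_sq z).hasFDerivAt.const_mul _).exp.const_mul _).differentiableAt

theorem sq_norm_mul_heatKernel_le {s : ℝ} (hs : 0 < s) (z : V) :
    ‖z‖ ^ 2 * heatKernel s z
      ≤ 8 * 2 ^ ((Module.finrank ℝ V : ℝ) / 2) * (s * heatKernel (2 * s) z) := by
  have hexp : ‖z‖ ^ 2 ≤ 8 * s * Real.exp ((8 * s)⁻¹ * ‖z‖ ^ 2) := by
    have h := Real.add_one_le_exp ((8 * s)⁻¹ * ‖z‖ ^ 2)
    calc ‖z‖ ^ 2 = 8 * s * ((8 * s)⁻¹ * ‖z‖ ^ 2) := by field_simp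
      _ ≤ _ := by gcongr; linarith
  have hnorm : (4 * π * s) ^ (-(Module.finrank ℝ V : ℝ) / 2)
      = 2 ^ ((Module.finrank ℝ V : ℝ) / 2) *
        (4 * π * (2 * s)) ^ (-(Module.finrank ℝ V : ℝ) / 2) := by
    rw [mul_left_comm, Real.mul_rpow two_pos.le (by positivity), ← mul_assoc,
      ← Real.rpow_add two_pos]
    ring_nf
    simp
  calc ‖z‖ ^ 2 * heatKernel s z
      ≤ 8 * s * Real.exp ((8 * s)⁻¹ * ‖z‖ ^ 2) * heatKernel s z :=
        mul_le_mul_of_nonneg_right hexp (heatKernel_nonneg hs.le z)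
    _ = 8 * s * (4 * π * s) ^ (-(Module.finrank ℝ V : ℝ) / 2) *
          Real.exp ((8 * s)⁻¹ * ‖z‖ ^ 2 + -(4 * s)⁻¹ * ‖z‖ ^ 2) := by
        rw [heatKernel, Real.exp_add]
        ring
    _ = 8 * s * (4 * π * s) ^ (-(Module.finrank ℝ V : ℝ) / 2) *
          Real.exp (-(4 * (2 * s))⁻¹ * ‖z‖ ^ 2) := by
        congr 2
        field_simp
        ring
    _ = _ := by
        rw [hnorm, heatKernel]
        ring

variable [MeasurableSpace V] [BorelSpace V]

theorem measurable_heatKernel : Measurable fun x : ℝ × V => heatKernel x.1 x.2 := by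
  unfold heatKernel
  fun_prop

variable [FiniteDimensional ℝ V]

theorem integrable_heatKernel {s : ℝ} (hs : 0 < s) : Integrable (heatKernel (V := V) s) := by
  have hre : 0 < (((4 * s)⁻¹ : ℝ) : ℂ).re := by
    rw [Complex.ofReal_re]
    positivity
  refine ((GaussianFourier.integrable_cexp_neg_mul_sq_norm_add hre 0 (0 : V)).norm.congr
    (ae_of_all _ fun z => ?_)).const_mul _
  simp only [Complex.norm_exp, zero_mul, add_zero]
  norm_cast

theorem integral_heatKernel_mul_cos {s : ℝ} (hs : 0 < s) (p : V) :
    ∫ z : V, heatKernel s z * Real.cos ⟪p, z⟫ = Real.exp (-s * ‖p‖ ^ 2) := by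
  have hre : 0 < (((4 * s)⁻¹ : ℝ) : ℂ).re := by
    rw [Complex.ofReal_re]
    positivity
  have hcos : ∀ z : V, Real.exp (-(4 * s)⁻¹ * ‖z‖ ^ 2) * Real.cos ⟪p, z⟫
      = (Complex.exp (-(((4 * s)⁻¹ : ℝ) : ℂ) * (‖z‖ : ℂ) ^ 2 + Complex.I * (⟪p, z⟫ : ℂ))).re := by
    intro z
    rw [Complex.exp_add, mul_comm Complex.I, Complex.exp_mul_I, ← Complex.ofReal_cos,
      ← Complex.ofReal_sin]
    norm_cast
    simp only [Complex.re_ofReal_mul, Complex.add_re, Complex.ofReal_re, Complex.I_re, mul_zero,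
      add_zero]
  have hval : (((π : ℂ) / (((4 * s)⁻¹ : ℝ) : ℂ)) ^ ((Module.finrank ℝ V : ℂ) / 2)
      * Complex.exp (Complex.I ^ 2 * (‖p‖ : ℂ) ^ 2 / (4 * (((4 * s)⁻¹ : ℝ) : ℂ)))).re
      = (4 * π * s) ^ ((Module.finrank ℝ V : ℝ) / 2) * Real.exp (-s * ‖p‖ ^ 2) := by
    rw [← Complex.ofReal_re ((4 * π * s) ^ ((Module.finrank ℝ V : ℝ) / 2) * _), Complex.ofReal_mul,
      Complex.ofReal_cpow (by positivity), Complex.I_sq]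
    push_cast
    congr 3
    · field_simp
    · field_simp
  have hint := integral_re (GaussianFourier.integrable_cexp_neg_mul_sq_norm_add hre Complex.I p)
  rw [GaussianFourier.integral_cexp_neg_mul_sq_norm_add hre] at hint
  simp only [RCLike.re_eq_complex_re, ← hcos, hval] at hint
  simp only [heatKernel, mul_assoc _ (Real.exp _)]
  rw [integral_const_mul, hint, ← mul_assoc, ← Real.rpow_add (by positivity)]
  simp [neg_div]

theorem integral_heatKernel {s : ℝ} (hs : 0 < s) : ∫ z : V, heatKernel s z = 1 := by
  simpa using integral_heatKernel_mul_cos hs (0 : V)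

theorem integrable_sq_norm_mul_heatKernel {s : ℝ} (hs : 0 < s) :
    Integrable fun z : V => ‖z‖ ^ 2 * heatKernel s z := by
  have hmeas : Measurable (heatKernel (V := V) s) :=
    measurable_heatKernel.comp measurable_prodMk_left
  refine (((integrable_heatKernel (V := V) (mul_pos two_pos hs)).const_mul s).const_mul
    (8 * 2 ^ ((Module.finrank ℝ V : ℝ) / 2))).mono' (by fun_prop) (ae_of_all _ fun z => ?_)
  rw [Real.norm_of_nonneg (mul_nonneg (sq_nonneg _) (heatKernel_nonneg hs.le z))]
  exact sq_norm_mul_heatKernel_le hs z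

theorem integrable_inner_mul_heatKernel {s : ℝ} (hs : 0 < s) (v : V) :
    Integrable fun z : V => ⟪v, z⟫ * heatKernel s z := by
  have hmeas : Measurable (heatKernel (V := V) s) :=
    measurable_heatKernel.comp measurable_prodMk_left
  refine (((integrable_heatKernel (V := V) hs).add (integrable_sq_norm_mul_heatKernel hs)).const_mul
    ‖v‖).mono' (by fun_prop) (ae_of_all _ fun z => ?_)
  have hz : ‖z‖ ≤ 1 + ‖z‖ ^ 2 := by nlinarith [sq_nonneg (‖z‖ - 1)]
  have hK := heatKernel_nonneg hs.le z
  rw [norm_mul, Real.norm_of_nonneg hK]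
  calc ‖⟪v, z⟫‖ * heatKernel s z ≤ ‖v‖ * (1 + ‖z‖ ^ 2) * heatKernel s z := by
        gcongr
        exact (norm_inner_le_norm v z).trans (by gcongr)
    _ = _ := by
        simp only [Pi.add_apply]
        ring

theorem integral_inner_mul_heatKernel_mul_sin {s : ℝ} (hs : 0 < s) (v p : V) :
    ∫ z : V, ⟪v, z⟫ * heatKernel s z * Real.sin ⟪p, z⟫
      = 2 * s * ⟪v, p⟫ * Real.exp (-s * ‖p‖ ^ 2) := by
  have hasFDerivAt_sin : ∀ z : V, HasFDerivAt (fun z : V => Real.sin ⟪p, z⟫)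
      (Real.cos ⟪p, z⟫ • innerSL ℝ p) z := fun z => (innerSL ℝ p).hasFDerivAt.sin
  have hsin : ∀ z : V, fderiv ℝ (fun z : V => Real.sin ⟪p, z⟫) z v
      = Real.cos ⟪p, z⟫ * ⟪v, p⟫ := by
    intro z
    rw [(hasFDerivAt_sin z).fderiv, real_inner_comm p v]
    rfl
  have hKint := integrable_heatKernel (V := V) hs
  have hparts := integral_mul_fderiv_eq_neg_fderiv_mul_of_integrable (μ := volume)
    (f := fun z : V => Real.sin ⟪p, z⟫) (g := heatKernel s) (v := v)
    (by
      simp only [hsin, mul_assoc]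
      exact (hKint.const_mul _).bdd_mul (c := 1) (by fun_prop)
        (ae_of_all _ fun z => Real.abs_cos_le_one _))
    (by
      simp only [fderiv_heatKernel]
      exact ((integrable_inner_mul_heatKernel hs v).const_mul _).bdd_mul (c := 1) (by fun_prop)
        (ae_of_all _ fun z => Real.abs_sin_le_one _))
    (hKint.bdd_mul (c := 1) (by fun_prop) (ae_of_all _ fun z => Real.abs_sin_le_one _))
    (fun z _ => (hasFDerivAt_sin z).differentiableAt) (fun z _ => differentiable_heatKernel s z)
  simp only [hsin, fderiv_heatKernel] at hparts
  have hleft : ∫ z : V, Real.sin ⟪p, z⟫ * (-(2 * s)⁻¹ * (⟪v, z⟫ * heatKernel s z))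
      = -(2 * s)⁻¹ * ∫ z : V, ⟪v, z⟫ * heatKernel s z * Real.sin ⟪p, z⟫ := by
    rw [← integral_const_mul]
    congr 1 with z
    ring
  have hright : ∫ z : V, Real.cos ⟪p, z⟫ * ⟪v, p⟫ * heatKernel s z
      = ⟪v, p⟫ * Real.exp (-s * ‖p‖ ^ 2) := by
    rw [← integral_heatKernel_mul_cos hs, ← integral_const_mul]
    congr 1 with z
    ring
  rw [hleft, hright] at hparts
  field_simp at hparts ⊢
  linarith

end HeatKernel

section HeatMixture

variable {V : Type*} [NormedAddCommGroup V] [InnerProductSpace ℝ V]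

/-- The superposition `∫₀^∞ w(s) heatKernel s z ds` of heat kernels with weight `w`. -/
noncomputable def heatMixture (w : ℝ → ℝ) (z : V) : ℝ :=
  ∫ s in Set.Ioi (0 : ℝ), w s * heatKernel s z

theorem abs_inner_mul_le (v z : V) {t b : ℝ} (ht : |t| ≤ b * ‖z‖) :
    |⟪v, z⟫ * t| ≤ ‖v‖ * b * ‖z‖ ^ 2 := by
  rw [abs_mul]
  calc |⟪v, z⟫| * |t| ≤ ‖v‖ * ‖z‖ * (b * ‖z‖) := by
        gcongr
        exact abs_real_inner_le_norm v z
    _ = ‖v‖ * b * ‖z‖ ^ 2 := by ring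

variable [MeasurableSpace V] [BorelSpace V] [FiniteDimensional ℝ V] {w : ℝ → ℝ}

theorem integrable_mul_heatKernel_two_mul_prod
    (hw : IntegrableOn (fun s => s * w s) (Set.Ioi 0)) :
    Integrable (fun x : ℝ × V => x.1 * w x.1 * heatKernel (2 * x.1) x.2)
      ((volume.restrict (Set.Ioi 0)).prod volume) := by
  have hmeas : Measurable fun x : ℝ × V => heatKernel (2 * x.1) x.2 :=
    measurable_heatKernel.comp (f := fun x : ℝ × V => (2 * x.1, x.2)) (by fun_prop)
  have hmeas_mul : AEStronglyMeasurable
      (fun x : ℝ × V => x.1 * w x.1 * heatKernel (2 * x.1) x.2)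
      ((volume.restrict (Set.Ioi 0)).prod volume) :=
    hw.aestronglyMeasurable.comp_fst.mul hmeas.aestronglyMeasurable
  refine (integrable_prod_iff hmeas_mul).2 ⟨ae_restrict_of_forall_mem measurableSet_Ioi fun s hs =>
    (integrable_heatKernel (mul_pos two_pos hs)).const_mul (s * w s), ?_⟩
  refine IntegrableOn.congr_fun hw.norm (fun s (hs : 0 < s) => ?_) measurableSet_Ioi
  have h2s : 0 < 2 * s := mul_pos two_pos hs
  simp only [norm_mul _ (heatKernel _ _), Real.norm_of_nonneg (heatKernel_nonneg h2s.le _)]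
  rw [integral_const_mul, integral_heatKernel h2s, mul_one]

theorem integrable_mul_heatKernel_prod (hw : IntegrableOn (fun s => s * w s) (Set.Ioi 0))
    {φ : V → ℝ} (hφ : Measurable φ) {c : ℝ} (hc : 0 ≤ c)
    (hφ_le : ∀ z, |φ z| ≤ c * ‖z‖ ^ 2) :
    Integrable (fun x : ℝ × V => w x.1 * (φ x.2 * heatKernel x.1 x.2))
      ((volume.restrict (Set.Ioi 0)).prod volume) := by
  have hw_meas : AEStronglyMeasurable w (volume.restrict (Set.Ioi 0)) := by
    refine (measurable_inv.aestronglyMeasurable.mul hw.aestronglyMeasurable).congr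
      (ae_restrict_of_forall_mem measurableSet_Ioi fun s hs => ?_)
    exact inv_mul_cancel_left₀ (ne_of_gt hs) _
  have hpos : ∀ᵐ x : ℝ × V ∂(volume.restrict (Set.Ioi (0 : ℝ))).prod volume, 0 < x.1 :=
    Measure.quasiMeasurePreserving_fst.ae (ae_restrict_mem measurableSet_Ioi)
  refine ((integrable_mul_heatKernel_two_mul_prod hw).norm.const_mul
    (c * (8 * 2 ^ ((Module.finrank ℝ V : ℝ) / 2)))).mono' ?_ ?_
  · have hK := measurable_heatKernel (V := V)
    exact hw_meas.comp_fst.mul (Measurable.aestronglyMeasurable (by fun_prop))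
  · filter_upwards [hpos] with x hx
    have hK := heatKernel_nonneg hx.le x.2
    rw [norm_mul, norm_mul, norm_mul, norm_mul, Real.norm_of_nonneg hx.le, Real.norm_of_nonneg hK,
      Real.norm_of_nonneg (heatKernel_nonneg (mul_pos two_pos hx).le x.2)]
    calc ‖w x.1‖ * (‖φ x.2‖ * heatKernel x.1 x.2)
        ≤ ‖w x.1‖ * (c * ‖x.2‖ ^ 2 * heatKernel x.1 x.2) := by
          gcongr
          exact hφ_le x.2
      _ = ‖w x.1‖ * c * (‖x.2‖ ^ 2 * heatKernel x.1 x.2) := by ring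
      _ ≤ ‖w x.1‖ * c * (8 * 2 ^ ((Module.finrank ℝ V : ℝ) / 2) *
            (x.1 * heatKernel (2 * x.1) x.2)) := by
          exact mul_le_mul_of_nonneg_left (sq_norm_mul_heatKernel_le hx x.2) (by positivity)
      _ = _ := by ring

theorem integrable_mul_heatMixture (hw : IntegrableOn (fun s => s * w s) (Set.Ioi 0))
    {φ : V → ℝ} (hφ : Measurable φ) {c : ℝ} (hc : 0 ≤ c)
    (hφ_le : ∀ z, |φ z| ≤ c * ‖z‖ ^ 2) :
    Integrable fun z => φ z * heatMixture w z := by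
  refine (integrable_mul_heatKernel_prod hw hφ hc hφ_le).integral_prod_right.congr
    (ae_of_all _ fun z => ?_)
  simp only [heatMixture, mul_left_comm (w _)]
  rw [integral_const_mul]

theorem integral_mul_heatMixture (hw : IntegrableOn (fun s => s * w s) (Set.Ioi 0))
    {φ : V → ℝ} (hφ : Measurable φ) {c : ℝ} (hc : 0 ≤ c)
    (hφ_le : ∀ z, |φ z| ≤ c * ‖z‖ ^ 2) :
    ∫ z, φ z * heatMixture w z
      = ∫ s in Set.Ioi (0 : ℝ), w s * ∫ z, φ z * heatKernel s z := by
  simp only [heatMixture, ← integral_const_mul]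
  rw [integral_integral_swap ((integrable_mul_heatKernel_prod hw hφ hc hφ_le).swap.congr
    (ae_of_all _ fun x => mul_left_comm _ _ _))]
  simp only [mul_left_comm (w _)]

theorem integrable_norm_mul_inner_mul_heatMixture
    (hw : IntegrableOn (fun s => s * w s) (Set.Ioi 0)) (v : V) :
    Integrable fun z : V => ‖z‖ * (⟪v, z⟫ * heatMixture w z) := by
  have h := integrable_mul_heatMixture hw (φ := fun z : V => ⟪v, z⟫ * ‖z‖) (by fun_prop)
    (by positivity) fun z => abs_inner_mul_le v z (b := 1) (by simp)
  exact h.congr (ae_of_all _ fun z => by ring)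

theorem integral_inner_mul_heatMixture_mul_sin
    (hw : IntegrableOn (fun s => s * w s) (Set.Ioi 0)) (v p : V) :
    ∫ z : V, ⟪v, z⟫ * heatMixture w z * Real.sin ⟪p, z⟫
      = 2 * ⟪v, p⟫ * ∫ s in Set.Ioi (0 : ℝ), s * w s * Real.exp (-s * ‖p‖ ^ 2) := by
  have hsin : ∀ z : V, |Real.sin ⟪p, z⟫| ≤ ‖p‖ * ‖z‖ := fun z =>
    Real.abs_sin_le_abs.trans (abs_real_inner_le_norm p z)
  have h := integral_mul_heatMixture hw (φ := fun z : V => ⟪v, z⟫ * Real.sin ⟪p, z⟫)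
    (by fun_prop) (by positivity) fun z => abs_inner_mul_le v z (hsin z)
  simp only [mul_right_comm _ (Real.sin _)] at h
  rw [h, ← integral_const_mul]
  refine setIntegral_congr_fun measurableSet_Ioi fun s hs => ?_
  simp only [integral_inner_mul_heatKernel_mul_sin hs]
  ring

end HeatMixture

section VelocityKernel

/-- The weight of the heat kernels in the velocity kernel: since
`∫₀^∞ 2 s velWeight(m, s) exp(-s |p|²) ds = (|p|² + m²)^{-1/2}`, it subordinates the inverse
energy to the heat semigroup. -/
noncomputable def velWeight (m s : ℝ) : ℝ :=
  (2 * √π)⁻¹ * (s ^ (-(3 / 2) : ℝ) * Real.exp (-(s * m ^ 2)))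

theorem mul_velWeight (m : ℝ) {s : ℝ} (hs : 0 < s) :
    s * velWeight m s = (2 * √π)⁻¹ * (s ^ ((1 / 2 : ℝ) - 1) * Real.exp (-(m ^ 2 * s))) := by
  have hpow : s ^ ((1 / 2 : ℝ) - 1) = s * s ^ (-(3 / 2) : ℝ) := by
    nth_rewrite 2 [← Real.rpow_one s]
    rw [← Real.rpow_add hs]
    norm_num
  rw [velWeight, hpow, mul_comm (m ^ 2)]
  ring

theorem integrableOn_mul_velWeight {m : ℝ} (hm : 0 < m) :
    IntegrableOn (fun s => s * velWeight m s) (Set.Ioi 0) := by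
  have h : IntegrableOn (fun s : ℝ => s ^ (-(1 / 2) : ℝ) * Real.exp (-(m ^ 2) * s ^ (1 : ℝ)))
      (Set.Ioi 0) :=
    integrableOn_rpow_mul_exp_neg_mul_rpow (by norm_num) one_pos (by positivity)
  refine IntegrableOn.congr_fun (h.const_mul (2 * √π)⁻¹) (fun s hs => ?_) measurableSet_Ioi
  rw [mul_velWeight m hs, Real.rpow_one, neg_mul]
  norm_num

theorem integral_mul_velWeight_mul_exp {m : ℝ} (hm : 0 < m) {n : ℕ} (p : Vec n) :
    ∫ s in Set.Ioi (0 : ℝ), s * velWeight m s * Real.exp (-s * ‖p‖ ^ 2)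
      = (2 * energy m p)⁻¹ := by
  have hE : 0 < energy m p := energy_pos hm p
  have hE_sq : energy m p ^ 2 = ‖p‖ ^ 2 + m ^ 2 := Real.sq_sqrt (by positivity)
  have hintegrand : ∀ s ∈ Set.Ioi (0 : ℝ), s * velWeight m s * Real.exp (-s * ‖p‖ ^ 2)
      = (2 * √π)⁻¹ * (s ^ ((1 / 2 : ℝ) - 1) * Real.exp (-(energy m p ^ 2 * s))) := by
    intro s hs
    rw [mul_velWeight m hs, mul_assoc, mul_assoc, ← Real.exp_add, hE_sq]
    ring_nf
  rw [setIntegral_congr_fun measurableSet_Ioi hintegrand, integral_const_mul,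
    Real.integral_rpow_mul_exp_neg_mul_Ioi (by norm_num) (by positivity), Real.Gamma_one_half_eq,
    ← Real.sqrt_eq_rpow, one_div, Real.sqrt_inv, Real.sqrt_sq hE.le]
  have : 0 < √π := by positivity
  field_simp

theorem heatMixture_velWeight {n : ℕ} {m : ℝ} (hm : 0 < m) {z : Vec n} (hz : z ≠ 0) :
    heatMixture (velWeight m) z = 2 * (2 * π) ^ (-((n : ℝ) + 1) / 2) *
      (m / ‖z‖) ^ (((n : ℝ) + 1) / 2) * besselK (((n : ℝ) + 1) / 2) (m * ‖z‖) := by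
  have hr : 0 < ‖z‖ := norm_pos_iff.2 hz
  have hintegrand : ∀ s ∈ Set.Ioi (0 : ℝ), velWeight m s * heatKernel s z
      = (2 * √π)⁻¹ * (4 * π) ^ (-(n : ℝ) / 2) *
        (s ^ (-(((n : ℝ) + 1) / 2 + 1)) * Real.exp (-(s * m ^ 2) - ‖z‖ ^ 2 / (4 * s))) := by
    intro s (hs : 0 < s)
    have hpow : s ^ (-(((n : ℝ) + 1) / 2 + 1)) = s ^ (-(3 / 2) : ℝ) * s ^ (-(n : ℝ) / 2) := by
      rw [← Real.rpow_add hs]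
      ring_nf
    have hexp : Real.exp (-(s * m ^ 2) - ‖z‖ ^ 2 / (4 * s))
        = Real.exp (-(s * m ^ 2)) * Real.exp (-(4 * s)⁻¹ * ‖z‖ ^ 2) := by
      rw [← Real.exp_add]
      ring_nf
    rw [velWeight, heatKernel, finrank_euclideanSpace_fin, Real.mul_rpow (by positivity) hs.le,
      hpow, hexp]
    ring
  have hconst : (2 * √π)⁻¹ * (4 * π) ^ (-(n : ℝ) / 2) * 2 ^ (((n : ℝ) + 1) / 2)
      = (2 * π) ^ (-((n : ℝ) + 1) / 2) := by
    have h2 : (2 : ℝ) ^ (-(n : ℝ) / 2) * 2 ^ (((n : ℝ) + 1) / 2) = √2 := by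
      rw [← Real.rpow_add two_pos, Real.sqrt_eq_rpow]
      ring_nf
    have hπ : (2 * √π)⁻¹ * √2 = (2 * π) ^ (-(1 / 2) : ℝ) := by
      rw [Real.rpow_neg (by positivity), ← Real.sqrt_eq_rpow, Real.sqrt_mul two_pos.le]
      have : √2 * √2 = 2 := Real.mul_self_sqrt two_pos.le
      field_simp
      linarith
    rw [show (4 : ℝ) * π = 2 * (2 * π) by ring, Real.mul_rpow two_pos.le (by positivity),
      show -((n : ℝ) + 1) / 2 = -(1 / 2) + -(n : ℝ) / 2 by ring, Real.rpow_add (by positivity),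
      ← hπ, ← h2]
    ring
  rw [heatMixture, setIntegral_congr_fun measurableSet_Ioi hintegrand, integral_const_mul,
    integral_rpow_mul_exp_neg_add_div _ hm hr, mul_div_assoc,
    Real.mul_rpow two_pos.le (by positivity), ← hconst]
  ring

theorem velKernel_eq_inner_mul_heatMixture {n : ℕ} {m : ℝ} (hm : 0 < m) (j : Fin n) (z : Vec n) :
    velKernel m j z = ⟪EuclideanSpace.single j (1 : ℝ), z⟫ * heatMixture (velWeight m) z := by
  rw [EuclideanSpace.inner_single_left]
  rcases eq_or_ne z 0 with rfl | hz
  · simp [velKernel]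
  · rw [heatMixture_velWeight hm hz, velKernel]
    simp [mul_comm]

theorem odd_velKernel {n : ℕ} (m : ℝ) (j : Fin n) : Function.Odd (velKernel (n := n) m j) := by
  intro z
  simp [velKernel]

theorem integrable_norm_mul_velKernel {n : ℕ} {m : ℝ} (hm : 0 < m) (j : Fin n) :
    Integrable fun z : Vec n => ‖z‖ * velKernel m j z := by
  simp only [velKernel_eq_inner_mul_heatMixture hm]
  exact integrable_norm_mul_inner_mul_heatMixture (integrableOn_mul_velWeight hm) _

theorem integral_velKernel_mul_sin {n : ℕ} {m : ℝ} (hm : 0 < m) (j : Fin n) (p : Vec n) :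
    ∫ z : Vec n, velKernel m j z * Real.sin ⟪p, z⟫ = p j / energy m p := by
  simp only [velKernel_eq_inner_mul_heatMixture hm]
  rw [integral_inner_mul_heatMixture_mul_sin (integrableOn_mul_velWeight hm),
    integral_mul_velWeight_mul_exp hm, EuclideanSpace.inner_single_left, map_one, one_mul]
  field_simp

end VelocityKernel

section UnitaryFourier

variable {V : Type*} [NormedAddCommGroup V] [InnerProductSpace ℝ V]

/-- The plane wave `exp(i p · x)`. -/
noncomputable def planeWave (p x : V) : ℂ := Complex.exp ((⟪p, x⟫ : ℂ) * Complex.I)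

theorem norm_planeWave (p x : V) : ‖planeWave p x‖ = 1 :=
  Complex.norm_exp_ofReal_mul_I _

@[fun_prop]
theorem continuous_planeWave_comp {X : Type*} [TopologicalSpace X] {f g : X → V}
    (hf : Continuous f) (hg : Continuous g) : Continuous fun t => planeWave (f t) (g t) := by
  unfold planeWave
  fun_prop

theorem conj_planeWave (p x : V) : conj (planeWave p x) = planeWave p (-x) := by
  rw [planeWave, planeWave, ← Complex.exp_conj, map_mul, Complex.conj_I, Complex.conj_ofReal,
    inner_neg_right, Complex.ofReal_neg, mul_neg, neg_mul]

theorem planeWave_sub (p x z : V) :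
    planeWave p (x - z)
      = planeWave p x * ((Real.cos ⟪p, z⟫ : ℂ) - Complex.I * (Real.sin ⟪p, z⟫ : ℂ)) := by
  rw [planeWave, planeWave, inner_sub_right, Complex.ofReal_sub, sub_mul, sub_eq_add_neg,
    Complex.exp_add, ← neg_mul, Complex.exp_mul_I (-(⟪p, z⟫ : ℂ)), Complex.cos_neg, Complex.sin_neg,
    Complex.ofReal_cos, Complex.ofReal_sin]
  ring

variable [MeasurableSpace V] [BorelSpace V] [FiniteDimensional ℝ V]

/-- The Fourier transform `(2π)^{-d/2} ∫ exp(-i p · x) f(x) dx`, unitary with respect to Lebesgue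
measure on both sides; Mathlib's `𝓕` has the factor `2π` in the exponent instead. -/
noncomputable def unitaryFourier (f : V → ℂ) (p : V) : ℂ :=
  (((2 * π) ^ (-(Module.finrank ℝ V : ℝ) / 2) : ℝ) : ℂ) * ∫ x, conj (planeWave p x) * f x

/-- The inverse Fourier transform `(2π)^{-d/2} ∫ exp(i p · x) g(p) dp`. -/
noncomputable def unitaryFourierInv (g : V → ℂ) (x : V) : ℂ :=
  (((2 * π) ^ (-(Module.finrank ℝ V : ℝ) / 2) : ℝ) : ℂ) * ∫ p, planeWave p x * g p

theorem unitaryFourier_const_mul (c : ℂ) (f : V → ℂ) (p : V) :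
    unitaryFourier (fun x => c * f x) p = c * unitaryFourier f p := by
  simp only [unitaryFourier, mul_left_comm _ c]
  rw [integral_const_mul, mul_left_comm]

theorem unitaryFourierInv_const_mul (c : ℂ) (g : V → ℂ) (x : V) :
    unitaryFourierInv (fun p => c * g p) x = c * unitaryFourierInv g x := by
  simp only [unitaryFourierInv, mul_left_comm _ c]
  rw [integral_const_mul, mul_left_comm]

theorem integrable_planeWave_mul {g : V → ℂ} (hg : Integrable g) (x : V) :
    Integrable fun p => planeWave p x * g p :=
  hg.bdd_mul (c := 1) (by fun_prop) (ae_of_all _ fun p => (norm_planeWave p x).le)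

theorem norm_unitaryFourierInv_le (g : V → ℂ) (x : V) :
    ‖unitaryFourierInv g x‖ ≤ (2 * π) ^ (-(Module.finrank ℝ V : ℝ) / 2) * ∫ p, ‖g p‖ := by
  rw [unitaryFourierInv, norm_mul, Complex.norm_real, Real.norm_of_nonneg (by positivity)]
  gcongr
  refine (norm_integral_le_integral_norm _).trans_eq ?_
  simp only [norm_mul, norm_planeWave, one_mul]

theorem continuous_unitaryFourierInv {g : V → ℂ} (hg : Integrable g) :
    Continuous (unitaryFourierInv g) := by
  refine continuous_const.mul (continuous_of_dominated (bound := fun p => ‖g p‖)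
    (fun x => (integrable_planeWave_mul hg x).aestronglyMeasurable)
    (fun x => ae_of_all _ fun p => ?_) hg.norm (ae_of_all _ fun p => by fun_prop))
  rw [norm_mul, norm_planeWave, one_mul]

theorem unitaryFourierInv_eq_fourierInv (g : V → ℂ) (x : V) :
    unitaryFourierInv g x =
      (((2 * π) ^ (-(Module.finrank ℝ V : ℝ) / 2) : ℝ) : ℂ) * 𝓕⁻ g ((2 * π)⁻¹ • x) := by
  simp only [unitaryFourierInv, Real.fourierInv_eq', inner_smul_right, planeWave, smul_eq_mul,
    mul_inv_cancel_left₀ Real.two_pi_pos.ne']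

theorem two_pi_rpow_mul_self_mul (d : ℝ) :
    (2 * π) ^ (-d / 2) * ((2 * π) ^ (-d / 2) * (2 * π) ^ d) = 1 := by
  rw [← Real.rpow_add Real.two_pi_pos, ← Real.rpow_add Real.two_pi_pos,
    show -d / 2 + (-d / 2 + d) = 0 by ring, Real.rpow_zero]

theorem two_pi_rpow_mul_self_mul_integral_comp_smul (F : V → ℂ) :
    (((2 * π) ^ (-(Module.finrank ℝ V : ℝ) / 2) : ℝ) : ℂ)
      * ((((2 * π) ^ (-(Module.finrank ℝ V : ℝ) / 2) : ℝ) : ℂ) * ∫ x, F ((2 * π)⁻¹ • x))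
      = ∫ y, F y := by
  rw [Measure.integral_comp_smul, inv_pow, inv_inv, abs_of_pos (by positivity), Complex.real_smul,
    ← Real.rpow_natCast, ← mul_assoc, ← mul_assoc, ← Complex.ofReal_mul, ← Complex.ofReal_mul,
    mul_assoc ((2 * π) ^ _), two_pi_rpow_mul_self_mul, Complex.ofReal_one, one_mul]

theorem integrable_unitaryFourierInv (g : 𝓢(V, ℂ)) : Integrable (unitaryFourierInv g) := by
  have h := ((𝓕⁻ g).integrable (μ := volume)).comp_smul (inv_ne_zero Real.two_pi_pos.ne')
  refine (h.const_mul (((2 * π) ^ (-(Module.finrank ℝ V : ℝ) / 2) : ℝ) : ℂ)).congr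
    (ae_of_all _ fun x => ?_)
  rw [unitaryFourierInv_eq_fourierInv, SchwartzMap.fourierInv_coe]

theorem unitaryFourier_unitaryFourierInv (g : 𝓢(V, ℂ)) (p : V) :
    unitaryFourier (unitaryFourierInv g) p = g p := by
  let F : V → ℂ := fun y => Complex.exp (((-2 * π * ⟪y, p⟫ : ℝ) : ℂ) * Complex.I) • (𝓕⁻ g) y
  have hrescale : ∀ x, conj (planeWave p x) * unitaryFourierInv g x
      = (((2 * π) ^ (-(Module.finrank ℝ V : ℝ) / 2) : ℝ) : ℂ) * F ((2 * π)⁻¹ • x) := by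
    intro x
    have hphase : -2 * π * ⟪(2 * π)⁻¹ • x, p⟫ = ⟪p, -x⟫ := by
      rw [real_inner_smul_left, real_inner_comm, inner_neg_right, neg_mul, neg_mul,
        mul_inv_cancel_left₀ Real.two_pi_pos.ne']
    rw [conj_planeWave, unitaryFourierInv_eq_fourierInv, mul_left_comm, planeWave, ← hphase,
      ← SchwartzMap.fourierInv_coe]
    rfl
  calc unitaryFourier (unitaryFourierInv g) p
      = ∫ y, F y := by
        simp only [unitaryFourier, hrescale]
        rw [integral_const_mul, two_pi_rpow_mul_self_mul_integral_comp_smul]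
    _ = 𝓕 (𝓕⁻ g) p := by rw [SchwartzMap.fourier_coe, Real.fourier_eq']
    _ = g p := by rw [FourierTransform.fourier_fourierInv_eq]

theorem integral_conj_unitaryFourierInv_mul (f g : 𝓢(V, ℂ)) :
    ∫ x, conj (unitaryFourierInv f x) * unitaryFourierInv g x = ∫ p, conj (f p) * g p := by
  let F : V → ℂ := fun y => conj ((𝓕⁻ f) y) * (𝓕⁻ g) y
  let c : ℂ := (((2 * π) ^ (-(Module.finrank ℝ V : ℝ) / 2) : ℝ) : ℂ)
  have hrescale : ∀ x, conj (unitaryFourierInv f x) * unitaryFourierInv g x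
      = c * (c * F ((2 * π)⁻¹ • x)) := by
    intro x
    simp only [unitaryFourierInv_eq_fourierInv, ← SchwartzMap.fourierInv_coe, map_mul,
      Complex.conj_ofReal, F, c]
    ring
  calc ∫ x, conj (unitaryFourierInv f x) * unitaryFourierInv g x
      = ∫ y, F y := by
        simp only [hrescale]
        rw [integral_const_mul, integral_const_mul, two_pi_rpow_mul_self_mul_integral_comp_smul]
    _ = ∫ p, conj (f p) * g p := by
        simpa only [FourierTransform.fourier_fourierInv_eq, RCLike.inner_apply,
          mul_comm _ (conj _)] using (SchwartzMap.integral_inner_fourier_fourier (𝓕⁻ f) (𝓕⁻ g)).symm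

theorem integrable_norm_sq_unitaryFourierInv (g : 𝓢(V, ℂ)) :
    Integrable fun x => ‖unitaryFourierInv g x‖ ^ 2 := by
  have h := (integrable_unitaryFourierInv g).norm
  simp only [sq]
  exact h.mul_bdd h.aestronglyMeasurable
    (ae_of_all _ fun x => (norm_norm _).trans_le (norm_unitaryFourierInv_le g x))

theorem integral_norm_sq_unitaryFourierInv (g : 𝓢(V, ℂ)) :
    ∫ x, ‖unitaryFourierInv g x‖ ^ 2 = ∫ p, ‖g p‖ ^ 2 := by
  have h := integral_conj_unitaryFourierInv_mul g g
  simp only [Complex.conj_mul', ← Complex.ofReal_pow] at h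
  rwa [integral_complex_ofReal, integral_complex_ofReal, Complex.ofReal_inj] at h

variable {Ω : Type*} [MeasurableSpace Ω] {ν : Measure Ω} [SFinite ν]

theorem stronglyMeasurable_unitaryFourierInv_prod {u : V × Ω → ℂ} (hu : StronglyMeasurable u) :
    StronglyMeasurable fun t : V × Ω => unitaryFourierInv (fun p => u (p, t.2)) t.1 := by
  have hwave : StronglyMeasurable fun s : (V × Ω) × V => planeWave s.2 s.1.1 :=
    (continuous_planeWave_comp continuous_snd continuous_fst).stronglyMeasurable.comp_measurable
      (g := fun s : (V × Ω) × V => (s.1.1, s.2)) (by fun_prop)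
  have hsection : StronglyMeasurable fun s : (V × Ω) × V => u (s.2, s.1.2) :=
    hu.comp_measurable (by fun_prop)
  exact (hwave.mul hsection).integral_prod_right'.const_mul _

theorem memLp_unitaryFourierInv_prod {u : V × Ω → ℂ} (hmeas : StronglyMeasurable u)
    (hschwartz : ∀ q, ∃ f : 𝓢(V, ℂ), ∀ p, f p = u (p, q)) (hu : MemLp u 2 (volume.prod ν)) :
    MemLp (fun t : V × Ω => unitaryFourierInv (fun p => u (p, t.2)) t.1) 2 (volume.prod ν) := by
  choose f hf using hschwartz
  have hmeas' := (stronglyMeasurable_unitaryFourierInv_prod hmeas).aestronglyMeasurable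
    (μ := volume.prod ν)
  rw [memLp_two_iff_integrable_sq_norm hmeas.aestronglyMeasurable] at hu
  refine (memLp_two_iff_integrable_sq_norm hmeas').2
    ((integrable_prod_iff' (hmeas'.norm.pow 2)).2 ?_)
  simp only [Pi.pow_apply, ← hf, norm_pow, norm_norm]
  refine ⟨ae_of_all _ fun q => integrable_norm_sq_unitaryFourierInv (f q), ?_⟩
  simp only [integral_norm_sq_unitaryFourierInv]
  simpa only [hf] using hu.integral_prod_right

end UnitaryFourier

section PrincipalValue

variable {V : Type*} [NormedAddCommGroup V] {κ : V → ℝ} {ε : ℝ}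

/-- The kernel `κ` with the ball of radius `ε` about the origin removed. -/
noncomputable def truncKernel (κ : V → ℝ) (ε : ℝ) : V → ℝ := {z | ε < ‖z‖}.indicator κ

theorem odd_truncKernel (hκ : Function.Odd κ) (ε : ℝ) : Function.Odd (truncKernel κ ε) := by
  intro z
  by_cases h : ε < ‖z‖ <;> simp [truncKernel, Set.indicator, h, hκ z]

theorem abs_truncKernel_le (κ : V → ℝ) (ε : ℝ) (z : V) : |truncKernel κ ε z| ≤ |κ z| :=
  norm_indicator_le_norm_self κ z

theorem indicator_norm_sub_mul (κ : V → ℝ) (ε : ℝ) (x : V) (f : V → ℂ) :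
    {y | ε < ‖x - y‖}.indicator (fun y => (κ (x - y) : ℂ) * f y)
      = fun y => (truncKernel κ ε (x - y) : ℂ) * f y := by
  funext y
  by_cases h : ε < ‖x - y‖ <;> simp [truncKernel, Set.indicator, h]

theorem measurableSet_lt_norm_sub [MeasurableSpace V] [BorelSpace V] (ε : ℝ) (x : V) :
    MeasurableSet {y : V | ε < ‖x - y‖} :=
  (isOpen_lt continuous_const (by fun_prop)).measurableSet

variable [InnerProductSpace ℝ V]

theorem norm_truncKernel_mul_sin_le (κ : V → ℝ) (ε : ℝ) (p z : V) :
    ‖truncKernel κ ε z * Real.sin ⟪p, z⟫‖ ≤ ‖p‖ * ‖‖z‖ * κ z‖ := by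
  have hsin : |Real.sin ⟪p, z⟫| ≤ ‖p‖ * ‖z‖ :=
    Real.abs_sin_le_abs.trans (abs_real_inner_le_norm p z)
  calc ‖truncKernel κ ε z * Real.sin ⟪p, z⟫‖
      = |truncKernel κ ε z| * |Real.sin ⟪p, z⟫| := abs_mul _ _
    _ ≤ |κ z| * (‖p‖ * ‖z‖) :=
        mul_le_mul (abs_truncKernel_le κ ε z) hsin (abs_nonneg _) (abs_nonneg _)
    _ = ‖p‖ * ‖‖z‖ * κ z‖ := by rw [norm_mul, norm_norm, Real.norm_eq_abs]; ring

variable [MeasurableSpace V] [BorelSpace V] [FiniteDimensional ℝ V]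

theorem integrable_truncKernel (hκ : Integrable fun z => ‖z‖ * κ z) (hε : 0 < ε) :
    Integrable (truncKernel κ ε) := by
  have hmeas : MeasurableSet {z : V | ε < ‖z‖} := measurableSet_lt measurable_const measurable_norm
  have hcut : Integrable fun z : V => {z | ε < ‖z‖}.indicator (fun z => ‖z‖⁻¹) z * (‖z‖ * κ z) := by
    refine hκ.bdd_mul (c := ε⁻¹) (measurable_norm.inv.indicator hmeas).aestronglyMeasurable
      (ae_of_all _ fun z => ?_)
    by_cases hz : ε < ‖z‖
    · simpa [Set.indicator, hz] using inv_anti₀ hε hz.le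
    · simpa [Set.indicator, hz] using hε.le
  refine hcut.congr (ae_of_all _ fun z => ?_)
  by_cases hz : ε < ‖z‖
  · simp [truncKernel, Set.indicator, hz, (hε.trans hz).ne']
  · simp [truncKernel, Set.indicator, hz]

/-- The sine transform `∫ κ(z) sin(p · z) dz`. For an odd kernel it is the Fourier transform up to
a factor `-i`, and it exists already when `κ` is integrable up to a simple pole at the origin. -/
noncomputable def sineTransform (κ : V → ℝ) (p : V) : ℝ := ∫ z, κ z * Real.sin ⟪p, z⟫

theorem continuous_sineTransform (hκ : Integrable κ) : Continuous (sineTransform κ) := by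
  refine continuous_of_dominated (bound := fun z => ‖κ z‖)
    (fun p => hκ.aestronglyMeasurable.mul (by fun_prop)) (fun p => ae_of_all _ fun z => ?_)
    hκ.norm (ae_of_all _ fun z => by fun_prop)
  rw [norm_mul]
  exact mul_le_of_le_one_right (norm_nonneg _) (Real.abs_sin_le_one _)

theorem norm_sineTransform_truncKernel_le (hκ : Integrable fun z => ‖z‖ * κ z) (ε : ℝ) (p : V) :
    ‖sineTransform (truncKernel κ ε) p‖ ≤ ‖p‖ * ∫ z, ‖‖z‖ * κ z‖ := by
  rw [← integral_const_mul]
  exact norm_integral_le_of_norm_le (hκ.norm.const_mul _)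
    (ae_of_all _ fun z => norm_truncKernel_mul_sin_le κ ε p z)

theorem tendsto_sineTransform_truncKernel (hκ : Integrable fun z => ‖z‖ * κ z) (p : V) :
    Tendsto (fun ε => sineTransform (truncKernel κ ε) p) (𝓝[>] 0) (𝓝 (sineTransform κ p)) := by
  refine tendsto_integral_filter_of_dominated_convergence (fun z => ‖p‖ * ‖‖z‖ * κ z‖) ?_
    (Eventually.of_forall fun ε => ae_of_all _ fun z => norm_truncKernel_mul_sin_le κ ε p z)
    (hκ.norm.const_mul _) (ae_of_all _ fun z => ?_)
  · filter_upwards [self_mem_nhdsWithin] with ε hε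
    exact (integrable_truncKernel hκ hε).aestronglyMeasurable.mul (by fun_prop)
  · rcases eq_or_ne z 0 with rfl | hz
    · simp only [inner_zero_right, Real.sin_zero, mul_zero, tendsto_const_nhds]
    · refine tendsto_const_nhds.congr' ?_
      filter_upwards [mem_nhdsWithin_of_mem_nhds (Iio_mem_nhds (norm_pos_iff.2 hz))] with ε hε
      rw [truncKernel, Set.indicator_of_mem (show z ∈ {z | ε < ‖z‖} from hε)]

theorem integral_mul_cos_eq_zero_of_odd (hκ : Function.Odd κ) (p : V) :
    ∫ z, κ z * Real.cos ⟪p, z⟫ = 0 := by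
  have h := integral_neg_eq_self (fun z => κ z * Real.cos ⟪p, z⟫) volume
  simp only [hκ _, inner_neg_right, Real.cos_neg, neg_mul, integral_neg] at h
  linarith

theorem integral_mul_planeWave_sub (hodd : Function.Odd κ) (hκ : Integrable κ) (p x : V) :
    ∫ z, (κ z : ℂ) * planeWave p (x - z) = planeWave p x * (-Complex.I * sineTransform κ p) := by
  have hcos : Integrable fun z => κ z * Real.cos ⟪p, z⟫ :=
    hκ.mul_bdd (c := 1) (by fun_prop) (ae_of_all _ fun z => Real.abs_cos_le_one _)
  have hsin : Integrable fun z => κ z * Real.sin ⟪p, z⟫ :=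
    hκ.mul_bdd (c := 1) (by fun_prop) (ae_of_all _ fun z => Real.abs_sin_le_one _)
  calc ∫ z, (κ z : ℂ) * planeWave p (x - z)
      = ∫ z, planeWave p x * (((κ z * Real.cos ⟪p, z⟫ : ℝ) : ℂ)
          - Complex.I * ((κ z * Real.sin ⟪p, z⟫ : ℝ) : ℂ)) := by
        congr 1 with z
        rw [planeWave_sub]
        push_cast
        ring
    _ = planeWave p x * (((∫ z, κ z * Real.cos ⟪p, z⟫ : ℝ) : ℂ)
          - Complex.I * (sineTransform κ p : ℂ)) := by
        rw [integral_const_mul, integral_sub hcos.ofReal (hsin.ofReal.const_mul _),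
          integral_const_mul, integral_complex_ofReal, integral_complex_ofReal, sineTransform]
    _ = planeWave p x * (-Complex.I * sineTransform κ p) := by
        rw [integral_mul_cos_eq_zero_of_odd hodd, Complex.ofReal_zero, zero_sub, neg_mul]

theorem integral_sub_mul_unitaryFourierInv (hodd : Function.Odd κ) (hκ : Integrable κ)
    {g : V → ℂ} (hg : Integrable g) (x : V) :
    ∫ y, (κ (x - y) : ℂ) * unitaryFourierInv g y
      = unitaryFourierInv (fun p => -Complex.I * sineTransform κ p * g p) x := by
  have hjoint : Integrable (fun t : V × V => (κ t.1 : ℂ) * (planeWave t.2 (x - t.1) * g t.2))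
      (volume.prod volume) := by
    refine ((hκ.ofReal.mul_prod hg).bdd_mul (c := 1)
      (f := fun t : V × V => planeWave t.2 (x - t.1)) (by fun_prop)
      (ae_of_all _ fun t => (norm_planeWave _ _).le)).congr (ae_of_all _ fun t => ?_)
    exact mul_left_comm _ _ _
  calc ∫ y, (κ (x - y) : ℂ) * unitaryFourierInv g y
      = ∫ z, (κ z : ℂ) * unitaryFourierInv g (x - z) := by
        rw [← integral_sub_left_eq_self _ volume x]
        simp only [sub_sub_cancel]
    _ = (((2 * π) ^ (-(Module.finrank ℝ V : ℝ) / 2) : ℝ) : ℂ)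
          * ∫ z, ∫ p, (κ z : ℂ) * (planeWave p (x - z) * g p) := by
        rw [← integral_const_mul]
        congr 1 with z
        rw [integral_const_mul, unitaryFourierInv, mul_left_comm]
    _ = (((2 * π) ^ (-(Module.finrank ℝ V : ℝ) / 2) : ℝ) : ℂ)
          * ∫ p, ∫ z, (κ z : ℂ) * (planeWave p (x - z) * g p) := by
        rw [integral_integral_swap hjoint]
    _ = unitaryFourierInv (fun p => -Complex.I * sineTransform κ p * g p) x := by
        rw [unitaryFourierInv]
        congr 2 with p
        simp only [← mul_assoc (κ _ : ℂ)]
        rw [integral_mul_const, integral_mul_planeWave_sub hodd hκ, mul_assoc]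

theorem integrableOn_sub_mul_unitaryFourierInv (hκ : Integrable fun z => ‖z‖ * κ z) (hε : 0 < ε)
    {g : V → ℂ} (hg : Integrable g) (x : V) :
    IntegrableOn (fun y => (κ (x - y) : ℂ) * unitaryFourierInv g y) {y | ε < ‖x - y‖} := by
  rw [← integrable_indicator_iff (measurableSet_lt_norm_sub ε x), indicator_norm_sub_mul]
  exact ((integrable_truncKernel hκ hε).comp_sub_left x).ofReal.mul_bdd
    (continuous_unitaryFourierInv hg).aestronglyMeasurable
    (ae_of_all _ fun y => norm_unitaryFourierInv_le g y)

theorem tendsto_setIntegral_sub_mul_unitaryFourierInv (hodd : Function.Odd κ)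
    (hκ : Integrable fun z => ‖z‖ * κ z) {g : V → ℂ} (hg : Integrable g)
    (hpg : Integrable fun p => ‖p‖ * ‖g p‖) (x : V) :
    Tendsto (fun ε => ∫ y in {y | ε < ‖x - y‖}, (κ (x - y) : ℂ) * unitaryFourierInv g y) (𝓝[>] 0)
      (𝓝 (unitaryFourierInv (fun p => -Complex.I * sineTransform κ p * g p) x)) := by
  have hconv : ∀ ε ∈ Set.Ioi (0 : ℝ),
      unitaryFourierInv (fun p => -Complex.I * sineTransform (truncKernel κ ε) p * g p) x
        = ∫ y in {y | ε < ‖x - y‖}, (κ (x - y) : ℂ) * unitaryFourierInv g y := by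
    intro ε hε
    rw [← integral_indicator (measurableSet_lt_norm_sub ε x), indicator_norm_sub_mul]
    exact (integral_sub_mul_unitaryFourierInv (odd_truncKernel hodd ε)
      (integrable_truncKernel hκ hε) hg x).symm
  refine Tendsto.congr' (eventually_nhdsWithin_of_forall hconv) (Tendsto.const_mul _ ?_)
  refine tendsto_integral_filter_of_dominated_convergence
    (fun p => (∫ z, ‖‖z‖ * κ z‖) * (‖p‖ * ‖g p‖)) ?_ ?_ (hpg.const_mul _) ?_
  · refine eventually_nhdsWithin_of_forall fun ε hε => ?_
    have := continuous_sineTransform (integrable_truncKernel hκ hε)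
    exact (Continuous.aestronglyMeasurable (by fun_prop)).mul
      ((Continuous.aestronglyMeasurable (by fun_prop)).mul hg.aestronglyMeasurable)
  · refine Eventually.of_forall fun ε => ae_of_all _ fun p => ?_
    rw [norm_mul, norm_mul, norm_mul, norm_planeWave, norm_neg, Complex.norm_I, Complex.norm_real,
      one_mul, one_mul, ← mul_assoc, mul_comm (∫ z, _)]
    gcongr
    exact norm_sineTransform_truncKernel_le hκ ε p
  · refine ae_of_all _ fun p => ((Tendsto.const_mul _ ?_).mul_const _).const_mul _
    exact (Complex.continuous_ofReal.tendsto _).comp (tendsto_sineTransform_truncKernel hκ p)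

end PrincipalValue

section Energy

variable {n : ℕ} {m : ℝ}

theorem energy_eq_mul_rpow (hm : 0 < m) (p : Vec n) :
    energy m p = m * (1 + ‖m⁻¹ • p‖ ^ 2) ^ (1 / 2 : ℝ) := by
  have hsq : ‖p‖ ^ 2 + m ^ 2 = m ^ 2 * (1 + ‖m⁻¹ • p‖ ^ 2) := by
    rw [norm_smul, norm_inv, Real.norm_of_nonneg hm.le]
    field_simp
    ring
  rw [energy, hsq, Real.sqrt_mul (sq_nonneg m), Real.sqrt_sq hm.le, ← Real.sqrt_eq_rpow]

theorem hasTemperateGrowth_energy_rpow (hm : 0 < m) (r : ℝ) :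
    Function.HasTemperateGrowth fun p : Vec n => energy m p ^ r := by
  have h : (fun p : Vec n => energy m p ^ r)
      = fun p => m ^ r * (1 + ‖m⁻¹ • p‖ ^ 2) ^ (1 / 2 * r : ℝ) := by
    funext p
    rw [energy_eq_mul_rpow hm, Real.mul_rpow hm.le (by positivity),
      ← Real.rpow_mul (by positivity)]
  rw [h]
  exact (Function.HasTemperateGrowth.const (m ^ r)).mul
    ((Function.hasTemperateGrowth_one_add_norm_sq_rpow (Vec n) (1 / 2 * r)).comp
      (m⁻¹ • ContinuousLinearMap.id ℝ (Vec n)).hasTemperateGrowth)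

theorem hasTemperateGrowth_inv_sqrt_energy (hm : 0 < m) :
    Function.HasTemperateGrowth fun p : Vec n => ((√(2 * energy m p))⁻¹ : ℂ) := by
  have h := Function.Complex.hasTemperateGrowth_ofReal.comp
    ((Function.HasTemperateGrowth.const (E := Vec n) (√2)⁻¹).mul
      (hasTemperateGrowth_energy_rpow hm (-(1 / 2))))
  refine (funext fun p => ?_ : _ = fun p : Vec n => _) ▸ h
  have hp := (energy_pos hm p).le
  rw [Function.comp_apply, Pi.mul_apply, Real.rpow_neg hp, ← Real.sqrt_eq_rpow, ← mul_inv,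
    ← Real.sqrt_mul zero_le_two, Complex.ofReal_inv]

/-- The symbol `p_j / ω_p` of the velocity operator. -/
noncomputable def velocity (m : ℝ) (j : Fin n) (p : Vec n) : ℂ :=
  ((lowerIdx p j / energy m p : ℝ) : ℂ)

theorem hasTemperateGrowth_velocity (hm : 0 < m) (j : Fin n) :
    Function.HasTemperateGrowth (velocity m j) := by
  have hcoord : Function.HasTemperateGrowth fun p : Vec n => p j :=
    (EuclideanSpace.proj (𝕜 := ℝ) j : Vec n →L[ℝ] ℝ).hasTemperateGrowth
  have h := Function.Complex.hasTemperateGrowth_ofReal.comp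
    (hcoord.neg.mul (hasTemperateGrowth_energy_rpow hm (-1)))
  refine (funext fun p => ?_ : _ = velocity m j) ▸ h
  simp [velocity, lowerIdx, Real.rpow_neg_one, div_eq_mul_inv]

theorem hasFDerivAt_energy (hm : 0 < m) (p : Vec n) :
    HasFDerivAt (energy m) ((energy m p)⁻¹ • innerSL ℝ p) p := by
  have h := ((hasStrictFDerivAt_norm_sq p).hasFDerivAt.add_const (m ^ 2)).sqrt (by positivity)
  convert! h using 1
  rw [energy]
  module

theorem fderiv_energy_single (hm : 0 < m) (j : Fin n) (p : Vec n) :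
    fderiv ℝ (fun p : Vec n => (energy m p : ℂ)) p (EuclideanSpace.single j 1)
      = -velocity m j p := by
  have h : HasFDerivAt (fun p : Vec n => (energy m p : ℂ)) _ p :=
    Complex.ofRealCLM.hasFDerivAt.comp p (hasFDerivAt_energy hm p)
  rw [h.fderiv]
  simp [velocity, lowerIdx, EuclideanSpace.inner_single_right, div_eq_inv_mul]

end Energy

section SymmetricFunctions

variable {α β : Type*} {k : ℕ}

/-- Invariance of a function of `k` variables under permutations of the variables. -/
def IsSymmetricFun (f : (Fin k → α) → β) : Prop :=
  ∀ (σ : Equiv.Perm (Fin k)) (q : Fin k → α), f (q ∘ σ) = f q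

theorem IsSymmetricFun.apply_cons_comp_succAbove {f : (Fin (k + 1) → α) → β}
    (hf : IsSymmetricFun f) (q : Fin (k + 1) → α) (i : Fin (k + 1)) :
    f (Fin.cons (q i) (q ∘ i.succAbove)) = f q := by
  rw [← hf i.cycleRange]
  congr 1
  funext l
  rw [Function.comp_apply, Fin.cons_apply_cycleRange (q i) (q ∘ i.succAbove) i l]
  exact congrFun (Fin.insertNth_self_removeNth i q) l

theorem IsSymmetricFun.comp_cons {f : (Fin (k + 1) → α) → β} (hf : IsSymmetricFun f) (p : α) :
    IsSymmetricFun fun q : Fin k → α => f (Fin.cons p q) := by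
  intro σ q
  have hcons : (Fin.cons p (q ∘ σ) : Fin (k + 1) → α)
      = (Fin.cons p q : Fin (k + 1) → α) ∘ Equiv.Perm.decomposeFin.symm (0, σ) := by
    funext i
    refine Fin.cases ?_ (fun i => ?_) i <;> simp
  exact (congrArg f hcons).trans (hf _ _)

theorem exists_perm_comp_succAbove (σ : Equiv.Perm (Fin (k + 1))) (i : Fin (k + 1)) :
    ∃ τ : Equiv.Perm (Fin k), σ ∘ i.succAbove = (σ i).succAbove ∘ τ := by
  let e : {a // a ≠ i} ≃ {b // b ≠ σ i} :=
    σ.subtypeEquiv fun a => (σ.injective.ne_iff (x := a) (y := i)).symm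
  refine ⟨((finSuccAboveEquiv i).trans e).trans (finSuccAboveEquiv (σ i)).symm, funext fun l => ?_⟩
  have h := (finSuccAboveEquiv (σ i)).apply_symm_apply (e (finSuccAboveEquiv i l))
  exact (congrArg Subtype.val h).symm

end SymmetricFunctions

section SecondQuantization

variable {n k : ℕ} {m : ℝ} {Ψ : WaveSeq n}

theorem isSymmetricFun_creInt (m : ℝ) {F : Vec n → WaveSeq n}
    (hF : ∀ p k, IsSymmetricFun (F p k)) (k : ℕ) : IsSymmetricFun (creInt m F k) := by
  intro σ q
  cases k with
  | zero => rfl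
  | succ k =>
    simp only [creInt]
    rw [← Equiv.sum_comp σ fun i => (√(2 * energy m (q i)) : ℂ) * F (q i) k (q ∘ i.succAbove)]
    congr 2 with i
    obtain ⟨τ, hτ⟩ := exists_perm_comp_succAbove σ i
    rw [Function.comp_assoc, hτ, ← Function.comp_assoc, hF, Function.comp_apply]

theorem creInt_const_smul (m : ℝ) (c : ℂ) (F : Vec n → WaveSeq n) :
    creInt m (fun p => c • F p) = c • creInt m F := by
  funext k q
  cases k with
  | zero => simp only [creInt, Pi.smul_apply, smul_zero]
  | succ k => simp only [creInt, Pi.smul_apply, smul_eq_mul, Finset.mul_sum, mul_left_comm _ c]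

theorem creInt_add (m : ℝ) (F G : Vec n → WaveSeq n) :
    creInt m (F + G) = creInt m F + creInt m G := by
  funext k q
  cases k with
  | zero => simp only [creInt, Pi.add_apply, add_zero]
  | succ k => simp only [creInt, Pi.add_apply, mul_add, Finset.sum_add_distrib]

theorem creInt_add_sum_mul (m : ℝ) (s : Vec n → ℂ) (F : Vec n → WaveSeq n) (q : Fin k → Vec n) :
    creInt m (fun p l r => (s p + ∑ i, s (r i)) * F p l r) k q
      = (∑ i, s (q i)) * creInt m F k q := by
  cases k with
  | zero => simp only [creInt, mul_zero]
  | succ k =>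
    have hsum : ∀ i : Fin (k + 1), s (q i) + ∑ l, s ((q ∘ i.succAbove) l) = ∑ l, s (q l) :=
      fun i => (Fin.sum_univ_succAbove (fun l => s (q l)) i).symm
    simp only [creInt, hsum, Finset.mul_sum, mul_left_comm _ (∑ l, s (q l))]

/-- The second quantization `∫ dp s(p) a*(p) a(p)` of the multiplication by a function `s` of the
momentum; `P_0` and `V_j` are the cases `s(p) = ω_p` and `s(p) = p_j / ω_p`. -/
noncomputable def secondQuant (m : ℝ) (s : Vec n → ℂ) (Ψ : WaveSeq n) : WaveSeq n :=
  creInt m fun p => s p • ann m p Ψ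

theorem opV_eq_secondQuant (m : ℝ) (j : Fin n) (Ψ : WaveSeq n) :
    opV m j Ψ = secondQuant m (velocity m j) Ψ := rfl

theorem secondQuant_apply (hm : 0 < m) (s : Vec n → ℂ) (hΨ : IsSymmetricFun (Ψ k))
    (q : Fin k → Vec n) : secondQuant m s Ψ k q = (∑ i, s (q i)) * Ψ k q := by
  cases k with
  | zero => simp only [secondQuant, creInt, Finset.univ_eq_empty, Finset.sum_empty, zero_mul]
  | succ k =>
    have hk : (√(k + 1) : ℂ) ≠ 0 := by exact_mod_cast (Real.sqrt_pos.2 (by positivity)).ne'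
    simp only [secondQuant, creInt, ann, annCov, Pi.smul_apply, smul_eq_mul, Finset.mul_sum,
      Finset.sum_mul, hΨ.apply_cons_comp_succAbove]
    refine Finset.sum_congr rfl fun i _ => ?_
    have hω : (√(2 * energy m (q i)) : ℂ) ≠ 0 := by
      have := energy_pos hm (q i)
      exact_mod_cast (Real.sqrt_pos.2 (by positivity)).ne'
    field_simp

theorem ann_secondQuant (hm : 0 < m) (s : Vec n → ℂ) (hΨ : IsSymmetricFun (Ψ (k + 1)))
    (p : Vec n) (q : Fin k → Vec n) :
    ann m p (secondQuant m s Ψ) k q = (s p + ∑ i, s (q i)) * ann m p Ψ k q := by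
  simp only [ann, annCov, Pi.smul_apply, smul_eq_mul, secondQuant_apply hm s hΨ, Fin.sum_univ_succ,
    Fin.cons_zero, Fin.cons_succ]
  ring

theorem isSymmetricFun_opX (m : ℝ) (j : Fin n) (hΨ : ∀ k, IsSymmetricFun (Ψ k)) (k : ℕ) :
    IsSymmetricFun (opX m j Ψ k) := by
  have hann : ∀ p k, IsSymmetricFun (ann m p Ψ k) := fun p k σ q => by
    simp only [ann, annCov, Pi.smul_apply, (hΨ (k + 1)).comp_cons p σ q]
  intro σ q
  refine congrArg (-Complex.I * ·) (isSymmetricFun_creInt m (fun p k σ q => ?_) k σ q)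
  simp only [hann _ k σ q]

theorem secondQuant_opX_sub_opX_secondQuant (hm : 0 < m) (j : Fin n) {s : Vec n → ℂ}
    (hs : Differentiable ℝ s) (hsymm : ∀ k, IsSymmetricFun (Ψ k))
    (hdiff : ∀ k q, Differentiable ℝ fun p => ann m p Ψ k q) :
    secondQuant m s (opX m j Ψ) - opX m j (secondQuant m s Ψ)
      = Complex.I • secondQuant m (fun p => fderiv ℝ s p (EuclideanSpace.single j 1)) Ψ := by
  let e : Vec n := EuclideanSpace.single j 1
  have hleibniz : ∀ p k q, fderiv ℝ (fun p => ann m p (secondQuant m s Ψ) k q) p e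
      = (s p + ∑ i, s (q i)) * fderiv ℝ (fun p => ann m p Ψ k q) p e
        + fderiv ℝ s p e * ann m p Ψ k q := by
    intro p k q
    simp only [ann_secondQuant hm s (hsymm (k + 1))]
    rw [fderiv_fun_mul ((hs p).add_const _) (hdiff k q p), fderiv_add_const]
    simp [mul_comm (ann m p Ψ k q)]
  have hsplit : (fun p k q => fderiv ℝ (fun p => ann m p (secondQuant m s Ψ) k q) p e)
      = (fun p k q => (s p + ∑ i, s (q i)) * fderiv ℝ (fun p => ann m p Ψ k q) p e)
        + fun p => fderiv ℝ s p e • ann m p Ψ := by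
    funext p k q
    exact hleibniz p k q
  funext k q
  have hopX : opX m j (secondQuant m s Ψ) k q = (∑ i, s (q i)) * opX m j Ψ k q
      - Complex.I * secondQuant m (fun p => fderiv ℝ s p e) Ψ k q := by
    rw [opX, hsplit, creInt_add, Pi.smul_apply, Pi.smul_apply, Pi.add_apply, Pi.add_apply,
      creInt_add_sum_mul, opX, Pi.smul_apply, Pi.smul_apply, secondQuant]
    simp only [smul_eq_mul]
    ring
  rw [Pi.sub_apply, Pi.sub_apply, hopX, secondQuant_apply hm s (isSymmetricFun_opX m j hsymm k),
    sub_sub_cancel, Pi.smul_apply, Pi.smul_apply, smul_eq_mul]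

end SecondQuantization

section SchwartzSections

variable {n k : ℕ} {m : ℝ} {Ψ : WaveSeq n}

theorem hasTemperateGrowth_finCons (q : Fin k → Vec n) :
    Function.HasTemperateGrowth fun p : Vec n => (Fin.cons p q : Fin (k + 1) → Vec n) := by
  have h : (fun p : Vec n => (Fin.cons p q : Fin (k + 1) → Vec n))
      = fun p => ContinuousLinearMap.single ℝ (fun _ : Fin (k + 1) => Vec n) 0 p
        + (Fin.cons 0 q : Fin (k + 1) → Vec n) := by
    funext p i
    refine Fin.cases ?_ (fun i => ?_) i <;> simp
  rw [h]
  exact (ContinuousLinearMap.hasTemperateGrowth _).add (Function.HasTemperateGrowth.const _)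

theorem antilipschitzWith_finCons (q : Fin k → Vec n) :
    AntilipschitzWith 1 fun p : Vec n => (Fin.cons p q : Fin (k + 1) → Vec n) := by
  refine AntilipschitzWith.of_le_mul_dist fun p p' => ?_
  simpa using dist_le_pi_dist (Fin.cons p q : Fin (k + 1) → Vec n) (Fin.cons p' q) 0

theorem exists_schwartz_mul_ann_cons (hm : 0 < m) {s : Vec n → ℂ} (hs : s.HasTemperateGrowth)
    (hΨ : IsSchwartzFock Ψ) (k : ℕ) :
    ∃ F : 𝓢(Fin (k + 1) → Vec n, ℂ), ∀ p q, F (Fin.cons p q) = s p * ann m p Ψ k q := by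
  obtain ⟨F, hF⟩ := hΨ.schwartz (k + 1)
  let b : (Fin (k + 1) → Vec n) → ℂ :=
    (s * fun p => ((√(2 * energy m p))⁻¹ : ℂ)) ∘
      ContinuousLinearMap.proj (R := ℝ) (φ := fun _ : Fin (k + 1) => Vec n) 0
  have hb : b.HasTemperateGrowth :=
    (hs.mul (hasTemperateGrowth_inv_sqrt_energy hm)).comp
      (ContinuousLinearMap.hasTemperateGrowth _)
  refine ⟨SchwartzMap.smulLeftCLM ℂ b ((√(k + 1) : ℂ) • F), fun p q => ?_⟩
  rw [SchwartzMap.smulLeftCLM_apply_apply hb]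
  simp only [b, smul_apply, ← hF, ann, annCov, Function.comp_apply, ContinuousLinearMap.proj_apply,
    Fin.cons_zero, Pi.mul_apply, Pi.smul_apply, smul_eq_mul, mul_assoc]

theorem exists_schwartz_mul_ann (hm : 0 < m) {s : Vec n → ℂ} (hs : s.HasTemperateGrowth)
    (hΨ : IsSchwartzFock Ψ) (k : ℕ) (q : Fin k → Vec n) :
    ∃ f : 𝓢(Vec n, ℂ), ∀ p, f p = s p * ann m p Ψ k q := by
  obtain ⟨F, hF⟩ := exists_schwartz_mul_ann_cons hm hs hΨ k
  exact ⟨SchwartzMap.compCLMOfAntilipschitz ℝ (hasTemperateGrowth_finCons q)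
    (antilipschitzWith_finCons q) F, fun p => hF p q⟩

theorem exists_schwartz_ann (hm : 0 < m) (hΨ : IsSchwartzFock Ψ) (k : ℕ) (q : Fin k → Vec n) :
    ∃ f : 𝓢(Vec n, ℂ), ∀ p, f p = ann m p Ψ k q := by
  simpa only [one_mul] using exists_schwartz_mul_ann hm (.const 1) hΨ k q

theorem opP0_opX_sub_opX_opP0 (hm : 0 < m) (j : Fin n) (hΨ : IsSchwartzFock Ψ) :
    opP0 m (opX m j Ψ) - opX m j (opP0 m Ψ) = (-Complex.I) • opV m j Ψ := by
  have hω : Differentiable ℝ fun p : Vec n => (energy m p : ℂ) := fun p =>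
    Complex.ofRealCLM.differentiableAt.comp p (hasFDerivAt_energy hm p).differentiableAt
  have hann : ∀ k q, Differentiable ℝ fun p => ann m p Ψ k q := fun k q => by
    obtain ⟨f, hf⟩ := exists_schwartz_ann hm hΨ k q
    exact funext hf ▸ f.differentiable
  calc opP0 m (opX m j Ψ) - opX m j (opP0 m Ψ)
      = Complex.I • secondQuant m (fun p => -velocity m j p) Ψ := by
        have h := secondQuant_opX_sub_opX_secondQuant hm j hω hΨ.symmetric hann
        simp only [fderiv_energy_single hm] at h
        exact h
    _ = (-Complex.I) • opV m j Ψ := by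
        have hneg : secondQuant m (fun p => -velocity m j p) Ψ = (-1 : ℂ) • opV m j Ψ := by
          simp only [secondQuant, ← neg_one_mul (velocity m j _), mul_smul]
          exact creInt_const_smul m _ _
        rw [hneg, smul_smul, mul_neg_one]

end SchwartzSections

section FockForm

variable {n k : ℕ} {m : ℝ}

/-- The density `∏ i, (2 ω_{p_i})⁻¹` of `dμ(p₁) ⋯ dμ(p_k)` with respect to the Lebesgue measure. -/
noncomputable def fockWeight (m : ℝ) (q : Fin k → Vec n) : ℝ := ∏ i, (2 * energy m (q i))⁻¹

theorem fockWeight_cons (m : ℝ) (p : Vec n) (q : Fin k → Vec n) :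
    fockWeight m (Fin.cons p q : Fin (k + 1) → Vec n) = (2 * energy m p)⁻¹ * fockWeight m q := by
  simp only [fockWeight, Fin.prod_univ_succ, Fin.cons_zero, Fin.cons_succ]

theorem isSymmetricFun_fockWeight (m : ℝ) :
    IsSymmetricFun (fockWeight m : (Fin k → Vec n) → ℝ) := fun σ q =>
  Equiv.prod_comp σ fun i => (2 * energy m (q i))⁻¹

theorem continuous_fockWeight (hm : 0 < m) :
    Continuous (fockWeight m : (Fin k → Vec n) → ℝ) := by
  have henergy : Continuous fun p : Vec n => energy m p := by unfold energy; fun_prop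
  refine continuous_finsetProd _ fun i _ => Continuous.inv₀ (by fun_prop) fun q => ?_
  have := energy_pos hm (q i)
  positivity

theorem norm_fockWeight_le (hm : 0 < m) (q : Fin k → Vec n) :
    ‖(fockWeight m q : ℂ)‖ ≤ (2 * m)⁻¹ ^ k := by
  have hfactor : ∀ i, ‖(2 * energy m (q i))⁻¹‖ ≤ (2 * m)⁻¹ := fun i => by
    have hle : m ≤ energy m (q i) := Real.le_sqrt_of_sq_le (le_add_of_nonneg_left (sq_nonneg _))
    rw [Real.norm_of_nonneg (by have := energy_pos hm (q i); positivity)]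
    gcongr
  rw [Complex.norm_real, fockWeight, norm_prod]
  exact (Finset.prod_le_prod (fun i _ => norm_nonneg _) fun i _ => hfactor i).trans_eq
    (Fin.prod_const k _)

theorem integrable_fockWeight_mul_conj_mul (hm : 0 < m) {X : Type*} [MeasurableSpace X]
    {μ : Measure (X × (Fin k → Vec n))} {f g : X × (Fin k → Vec n) → ℂ} (hf : MemLp f 2 μ)
    (hg : MemLp g 2 μ) :
    Integrable (fun y => (fockWeight m y.2 : ℂ) * (conj (f y) * g y)) μ :=
  (hf.star.integrable_mul hg).bdd_mul
    ((Complex.continuous_ofReal.comp (continuous_fockWeight hm)).measurable.comp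
      measurable_snd).aestronglyMeasurable
    (ae_of_all _ fun y => norm_fockWeight_le hm y.2)

theorem fockInner_eq_sum_range (m : ℝ) (Φ : WaveSeq n) {Ψ : WaveSeq n} {N : ℕ}
    (hΨ : ∀ k, N ≤ k → Ψ k = 0) :
    fockInner m Φ Ψ = ∑ k ∈ Finset.range N,
      ∫ q : Fin k → Vec n, (fockWeight m q : ℂ) * (conj (Φ k q) * Ψ k q) := by
  refine tsum_eq_sum fun k hk => ?_
  simp only [hΨ k (not_lt.1 fun h => hk (Finset.mem_range.2 h)), Pi.zero_apply, mul_zero,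
    integral_zero]

theorem fockInner_smul_right (m : ℝ) (c : ℂ) (Φ Ψ : WaveSeq n) :
    fockInner m Φ (c • Ψ) = c * fockInner m Φ Ψ := by
  simp only [fockInner, Pi.smul_apply, smul_eq_mul, mul_left_comm _ c, integral_const_mul,
    tsum_mul_left]

variable {G H : Vec n → WaveSeq n} {N : ℕ}

theorem integrable_fockInner (hH : ∀ x k, N ≤ k → H x k = 0)
    (hint : ∀ k, Integrable (fun y : Vec n × (Fin k → Vec n) =>
      (fockWeight m y.2 : ℂ) * (conj (G y.1 k y.2) * H y.1 k y.2)) (volume.prod volume)) :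
    Integrable fun x => fockInner m (G x) (H x) := by
  simp only [fun x => fockInner_eq_sum_range m (G x) (hH x)]
  exact integrable_finsetSum _ fun k _ => (hint k).integral_prod_left

theorem integral_fockInner (hH : ∀ x k, N ≤ k → H x k = 0)
    (hint : ∀ k, Integrable (fun y : Vec n × (Fin k → Vec n) =>
      (fockWeight m y.2 : ℂ) * (conj (G y.1 k y.2) * H y.1 k y.2)) (volume.prod volume)) :
    ∫ x, fockInner m (G x) (H x) = ∑ k ∈ Finset.range N, ∫ y : Vec n × (Fin k → Vec n),
      (fockWeight m y.2 : ℂ) * (conj (G y.1 k y.2) * H y.1 k y.2) ∂(volume.prod volume) := by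
  simp only [fun x => fockInner_eq_sum_range m (G x) (hH x)]
  rw [integral_finsetSum _ fun k _ => (hint k).integral_prod_left]
  exact Finset.sum_congr rfl fun k _ => (integral_prod _ (hint k)).symm

end FockForm

section MomentumForm

variable {n k : ℕ} {m : ℝ} {Φ Ψ : WaveSeq n} {s : Vec n → ℂ}

theorem measurePreserving_finCons {α : Type*} [MeasureSpace α] [SigmaFinite (volume : Measure α)]
    (k : ℕ) :
    MeasurePreserving fun y : α × (Fin k → α) => (Fin.cons y.1 y.2 : Fin (k + 1) → α) := by
  convert! (volume_preserving_piFinSuccAbove (fun _ : Fin (k + 1) => α) 0).symm using 1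
  funext y
  simp [MeasurableEquiv.piFinSuccAbove, Fin.insertNthEquiv]

theorem integral_sum_mul_of_isSymmetricFun {α : Type*} [MeasureSpace α]
    [SigmaFinite (volume : Measure α)] {f : α → ℂ} {F : (Fin (k + 1) → α) → ℂ}
    (hF : IsSymmetricFun F)
    (hint : Integrable (fun y : α × (Fin k → α) => f y.1 * F (Fin.cons y.1 y.2))
      (volume.prod volume)) :
    ∫ q, (∑ i, f (q i)) * F q
      = (k + 1) * ∫ y : α × (Fin k → α), f y.1 * F (Fin.cons y.1 y.2) ∂(volume.prod volume) := by
  let g : α × (Fin k → α) → ℂ := fun y => f y.1 * F (Fin.cons y.1 y.2)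
  let e (i : Fin (k + 1)) := MeasurableEquiv.piFinSuccAbove (fun _ : Fin (k + 1) => α) i
  have he : ∀ i, MeasurePreserving (e i) := volume_preserving_piFinSuccAbove _
  have hterm : ∀ i q, f (q i) * F q = g (e i q) := fun i q =>
    congrArg (f (q i) * ·) (hF.apply_cons_comp_succAbove q i).symm
  have hcomp : ∀ i, Integrable fun q => g (e i q) := fun i =>
    ((he i).integrable_comp_emb (e i).measurableEmbedding).2 hint
  simp only [Finset.sum_mul, hterm]
  rw [integral_finsetSum _ fun i _ => hcomp i]
  simp only [fun i => (he i).integral_comp (e i).measurableEmbedding g, Finset.sum_const,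
    Finset.card_univ, Fintype.card_fin, nsmul_eq_mul, Nat.cast_add, Nat.cast_one]
  rfl

theorem stronglyMeasurable_mul_ann (hm : 0 < m) (hs : s.HasTemperateGrowth)
    (hΨ : IsSchwartzFock Ψ) (k : ℕ) :
    StronglyMeasurable fun y : Vec n × (Fin k → Vec n) => s y.1 * ann m y.1 Ψ k y.2 := by
  obtain ⟨F, hF⟩ := exists_schwartz_mul_ann_cons hm hs hΨ k
  simp only [← hF]
  exact F.continuous.stronglyMeasurable.comp_measurable (measurePreserving_finCons k).measurable

theorem memLp_mul_ann (hm : 0 < m) (hs : s.HasTemperateGrowth) (hΨ : IsSchwartzFock Ψ) (k : ℕ) :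
    MemLp (fun y : Vec n × (Fin k → Vec n) => s y.1 * ann m y.1 Ψ k y.2) 2
      (volume.prod volume) := by
  obtain ⟨F, hF⟩ := exists_schwartz_mul_ann_cons hm hs hΨ k
  have : (volume : Measure (Fin (k + 1) → Vec n)).IsAddHaarMeasure := by
    change (Measure.pi fun _ => volume).IsAddHaarMeasure
    infer_instance
  simp only [← hF]
  exact (F.memLp 2 volume).comp_measurePreserving (measurePreserving_finCons k)

theorem fockWeight_mul_conj_ann_mul_ann (hm : 0 < m) (Φ Ψ : WaveSeq n) (p : Vec n)
    (q : Fin k → Vec n) :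
    (fockWeight m q : ℂ) * (conj (ann m p Φ k q) * ann m p Ψ k q)
      = (k + 1) * ((fockWeight m (Fin.cons p q : Fin (k + 1) → Vec n) : ℂ)
        * (conj (Φ (k + 1) (Fin.cons p q)) * Ψ (k + 1) (Fin.cons p q))) := by
  have hω : (((√(2 * energy m p))⁻¹ : ℝ) : ℂ) * ((√(2 * energy m p))⁻¹ : ℝ)
      = ((2 * energy m p)⁻¹ : ℝ) := by
    have := energy_pos hm p
    rw [← Complex.ofReal_mul, ← mul_inv, Real.mul_self_sqrt (by positivity)]
  have hk : ((√(k + 1) : ℝ) : ℂ) * (√(k + 1) : ℝ) = k + 1 := by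
    rw [← Complex.ofReal_mul, Real.mul_self_sqrt (by positivity)]
    push_cast
    rfl
  rw [fockWeight_cons, Complex.ofReal_mul, ← hω, ← hk]
  simp only [ann, annCov, Pi.smul_apply, smul_eq_mul, map_mul, ← Complex.ofReal_inv,
    Complex.conj_ofReal]
  ring

theorem ann_eq_zero (m : ℝ) (p : Vec n) (hΨ : Ψ (k + 1) = 0) : ann m p Ψ k = 0 := by
  funext q
  simp only [ann, annCov, hΨ, Pi.smul_apply, Pi.zero_apply, smul_zero, mul_zero]

theorem integrable_fockWeight_mul_conj_ann_mul_ann (hm : 0 < m) (hs : s.HasTemperateGrowth)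
    (hΦ : IsSchwartzFock Φ) (hΨ : IsSchwartzFock Ψ) (k : ℕ) :
    Integrable (fun y : Vec n × (Fin k → Vec n) =>
      (fockWeight m y.2 : ℂ) * (conj (ann m y.1 Φ k y.2) * (s y.1 * ann m y.1 Ψ k y.2)))
      (volume.prod volume) := by
  refine integrable_fockWeight_mul_conj_mul hm ?_ (memLp_mul_ann hm hs hΨ k)
  simpa only [one_mul] using memLp_mul_ann hm (.const 1) hΦ k

theorem integral_fockWeight_mul_conj_mul_secondQuant (hm : 0 < m) (hs : s.HasTemperateGrowth)
    (hΦ : IsSchwartzFock Φ) (hΨ : IsSchwartzFock Ψ) (k : ℕ) :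
    ∫ q : Fin (k + 1) → Vec n,
      (fockWeight m q : ℂ) * (conj (Φ (k + 1) q) * secondQuant m s Ψ (k + 1) q)
      = ∫ y : Vec n × (Fin k → Vec n), (fockWeight m y.2 : ℂ)
        * (conj (ann m y.1 Φ k y.2) * (s y.1 * ann m y.1 Ψ k y.2)) ∂(volume.prod volume) := by
  let F : (Fin (k + 1) → Vec n) → ℂ := fun q =>
    (fockWeight m q : ℂ) * (conj (Φ (k + 1) q) * Ψ (k + 1) q)
  have hF : IsSymmetricFun F := fun σ q => by
    simp only [F, isSymmetricFun_fockWeight m σ q, hΦ.symmetric, hΨ.symmetric]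
  have hk : (k + 1 : ℂ) ≠ 0 := by exact_mod_cast k.succ_ne_zero
  have hcons : ∀ y : Vec n × (Fin k → Vec n), (fockWeight m y.2 : ℂ)
      * (conj (ann m y.1 Φ k y.2) * (s y.1 * ann m y.1 Ψ k y.2))
      = (k + 1) * (s y.1 * F (Fin.cons y.1 y.2)) := fun y => by
    linear_combination s y.1 * fockWeight_mul_conj_ann_mul_ann hm Φ Ψ y.1 y.2
  have hint := integrable_fockWeight_mul_conj_ann_mul_ann hm hs hΦ hΨ k
  simp only [hcons, integrable_const_mul_iff hk.isUnit] at hint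
  calc _ = ∫ q, (∑ i, s (q i)) * F q := by
        congr 1 with q
        rw [secondQuant_apply hm s (hΨ.symmetric (k + 1))]
        ring
    _ = (k + 1) * ∫ y : Vec n × (Fin k → Vec n), s y.1 * F (Fin.cons y.1 y.2)
          ∂(volume.prod volume) := integral_sum_mul_of_isSymmetricFun hF hint
    _ = _ := by simp only [hcons, integral_const_mul]

theorem integrable_fockInner_ann (hm : 0 < m) (hs : s.HasTemperateGrowth)
    (hΦ : IsSchwartzFock Φ) (hΨ : IsSchwartzFock Ψ) :
    Integrable fun p => fockInner m (ann m p Φ) (s p • ann m p Ψ) := by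
  obtain ⟨N, hN⟩ := hΨ.finite
  refine integrable_fockInner (N := N) (fun p k hk => ?_)
    (integrable_fockWeight_mul_conj_ann_mul_ann hm hs hΦ hΨ)
  rw [Pi.smul_apply, ann_eq_zero m p (hN _ (Nat.lt_succ_of_le hk)), smul_zero]

theorem integral_fockInner_ann (hm : 0 < m) (hs : s.HasTemperateGrowth)
    (hΦ : IsSchwartzFock Φ) (hΨ : IsSchwartzFock Ψ) {N : ℕ} (hN : ∀ k, N < k → Ψ k = 0) :
    ∫ p, fockInner m (ann m p Φ) (s p • ann m p Ψ)
      = ∑ k ∈ Finset.range N, ∫ y : Vec n × (Fin k → Vec n), (fockWeight m y.2 : ℂ)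
        * (conj (ann m y.1 Φ k y.2) * (s y.1 * ann m y.1 Ψ k y.2)) ∂(volume.prod volume) := by
  have hann : ∀ p k, N ≤ k → (s p • ann m p Ψ) k = 0 := fun p k hk => by
    rw [Pi.smul_apply, ann_eq_zero m p (hN _ (Nat.lt_succ_of_le hk)), smul_zero]
  exact integral_fockInner (H := fun p => s p • ann m p Ψ) hann
    (integrable_fockWeight_mul_conj_ann_mul_ann hm hs hΦ hΨ)

theorem fockInner_secondQuant (hm : 0 < m) (hs : s.HasTemperateGrowth)
    (hΦ : IsSchwartzFock Φ) (hΨ : IsSchwartzFock Ψ) :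
    fockInner m Φ (secondQuant m s Ψ) = ∫ p, fockInner m (ann m p Φ) (s p • ann m p Ψ) := by
  obtain ⟨N, hN⟩ := hΨ.finite
  have hquant : ∀ k, N + 1 ≤ k → secondQuant m s Ψ k = 0 := fun k hk => funext fun q => by
    rw [secondQuant_apply hm s (hΨ.symmetric k), hN k hk, Pi.zero_apply, mul_zero]
  have hvacuum : ∀ q, secondQuant m s Ψ 0 q = 0 := fun _ => rfl
  rw [fockInner_eq_sum_range m Φ hquant, Finset.sum_range_succ',
    integral_fockInner_ann hm hs hΦ hΨ hN]
  simp only [hvacuum, mul_zero, integral_zero, add_zero,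
    integral_fockWeight_mul_conj_mul_secondQuant hm hs hΦ hΨ]

end MomentumForm

section CoordinateSpace

variable {n k : ℕ} {m : ℝ} {Φ Ψ : WaveSeq n} {s : Vec n → ℂ}

theorem exp_neg_I_mul_contr (p x : Vec n) :
    Complex.exp (-(Complex.I * (contr p x : ℂ))) = planeWave p x := by
  have hcontr : contr p x = -⟪p, x⟫ := by simp [contr, lowerIdx, PiLp.inner_apply, mul_comm]
  rw [hcontr, planeWave, Complex.ofReal_neg, mul_neg, neg_neg, mul_comm]

theorem exp_I_mul_contr (p x : Vec n) :
    Complex.exp (Complex.I * (contr p x : ℂ)) = conj (planeWave p x) := by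
  rw [← exp_neg_I_mul_contr, ← Complex.exp_conj, map_neg, map_mul, Complex.conj_I,
    Complex.conj_ofReal, neg_mul, neg_neg]

/-- The annihilation operator of coordinate space with the additional multiplier `s`,
`(2π)^{-n/2} ∫ dp e^{-i p_k x^k} s(p) a(p)`. -/
noncomputable def annXMul (m : ℝ) (s : Vec n → ℂ) (x : Vec n) (Ψ : WaveSeq n) : WaveSeq n :=
  fun k q => unitaryFourierInv (fun p => s p * ann m p Ψ k q) x

theorem annX_apply (m : ℝ) (x : Vec n) (Ψ : WaveSeq n) (q : Fin k → Vec n) :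
    annX m x Ψ k q = unitaryFourierInv (fun p => ann m p Ψ k q) x := by
  simp only [annX, unitaryFourierInv, exp_neg_I_mul_contr, finrank_euclideanSpace_fin]

theorem creIntX_eq_creInt_unitaryFourier (m : ℝ) (G : Vec n → WaveSeq n) :
    creIntX m G = creInt m fun p k q => unitaryFourier (fun x => G x k q) p := by
  simp only [creIntX, unitaryFourier, exp_I_mul_contr, finrank_euclideanSpace_fin]

theorem creIntX_const_smul (m : ℝ) (c : ℂ) (G : Vec n → WaveSeq n) :
    creIntX m (fun x => c • G x) = c • creIntX m G := by
  simp only [creIntX_eq_creInt_unitaryFourier, Pi.smul_apply, smul_eq_mul,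
    unitaryFourier_const_mul]
  exact creInt_const_smul m c _

theorem integrable_annXMul (hm : 0 < m) (hs : s.HasTemperateGrowth) (hΨ : IsSchwartzFock Ψ)
    (k : ℕ) (q : Fin k → Vec n) : Integrable fun x => annXMul m s x Ψ k q := by
  obtain ⟨f, hf⟩ := exists_schwartz_mul_ann hm hs hΨ k q
  simpa only [annXMul, ← hf] using integrable_unitaryFourierInv f

theorem creIntX_annXMul (hm : 0 < m) (hs : s.HasTemperateGrowth) (hΨ : IsSchwartzFock Ψ) :
    creIntX m (fun x => annXMul m s x Ψ) = secondQuant m s Ψ := by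
  rw [creIntX_eq_creInt_unitaryFourier, secondQuant]
  congr 1
  funext p k q
  obtain ⟨f, hf⟩ := exists_schwartz_mul_ann hm hs hΨ k q
  simp only [annXMul, ← hf, unitaryFourier_unitaryFourierInv]
  exact hf p

theorem memLp_annXMul (hm : 0 < m) (hs : s.HasTemperateGrowth) (hΨ : IsSchwartzFock Ψ) (k : ℕ) :
    MemLp (fun y : Vec n × (Fin k → Vec n) => annXMul m s y.1 Ψ k y.2) 2
      (volume.prod volume) :=
  memLp_unitaryFourierInv_prod (u := fun y => s y.1 * ann m y.1 Ψ k y.2)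
    (stronglyMeasurable_mul_ann hm hs hΨ k)
    (exists_schwartz_mul_ann hm hs hΨ k) (memLp_mul_ann hm hs hΨ k)

theorem integrable_fockWeight_mul_conj_annX_mul_annXMul (hm : 0 < m) (hs : s.HasTemperateGrowth)
    (hΦ : IsSchwartzFock Φ) (hΨ : IsSchwartzFock Ψ) (k : ℕ) :
    Integrable (fun y : Vec n × (Fin k → Vec n) =>
      (fockWeight m y.2 : ℂ) * (conj (annX m y.1 Φ k y.2) * annXMul m s y.1 Ψ k y.2))
      (volume.prod volume) := by
  refine integrable_fockWeight_mul_conj_mul hm ?_ (memLp_annXMul hm hs hΨ k)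
  simpa only [annXMul, annX_apply, one_mul] using memLp_annXMul hm (.const 1) hΦ k

theorem integral_fockWeight_mul_conj_annX_mul_annXMul (hm : 0 < m) (hs : s.HasTemperateGrowth)
    (hΦ : IsSchwartzFock Φ) (hΨ : IsSchwartzFock Ψ) (k : ℕ) :
    ∫ y : Vec n × (Fin k → Vec n), (fockWeight m y.2 : ℂ)
        * (conj (annX m y.1 Φ k y.2) * annXMul m s y.1 Ψ k y.2) ∂(volume.prod volume)
      = ∫ y : Vec n × (Fin k → Vec n), (fockWeight m y.2 : ℂ)
        * (conj (ann m y.1 Φ k y.2) * (s y.1 * ann m y.1 Ψ k y.2)) ∂(volume.prod volume) := by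
  rw [integral_prod_symm _ (integrable_fockWeight_mul_conj_annX_mul_annXMul hm hs hΦ hΨ k),
    integral_prod_symm _ (integrable_fockWeight_mul_conj_ann_mul_ann hm hs hΦ hΨ k)]
  congr 1 with q
  obtain ⟨f, hf⟩ := exists_schwartz_ann hm hΦ k q
  obtain ⟨g, hg⟩ := exists_schwartz_mul_ann hm hs hΨ k q
  simp only [integral_const_mul, annX_apply, annXMul, ← hf, ← hg,
    integral_conj_unitaryFourierInv_mul]

theorem annXMul_eq_zero (m : ℝ) (s : Vec n → ℂ) (x : Vec n) (hΨ : Ψ (k + 1) = 0) :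
    annXMul m s x Ψ k = 0 := by
  funext q
  simp only [annXMul, ann_eq_zero m _ hΨ, unitaryFourierInv, Pi.zero_apply, mul_zero,
    integral_zero]

theorem integrable_fockInner_annX_annXMul (hm : 0 < m) (hs : s.HasTemperateGrowth)
    (hΦ : IsSchwartzFock Φ) (hΨ : IsSchwartzFock Ψ) :
    Integrable fun x => fockInner m (annX m x Φ) (annXMul m s x Ψ) := by
  obtain ⟨N, hN⟩ := hΨ.finite
  exact integrable_fockInner
    (fun x k hk => annXMul_eq_zero m s x (hN _ (Nat.lt_succ_of_le hk)))
    (integrable_fockWeight_mul_conj_annX_mul_annXMul hm hs hΦ hΨ)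

theorem fockInner_secondQuant_eq_integral_annX (hm : 0 < m) (hs : s.HasTemperateGrowth)
    (hΦ : IsSchwartzFock Φ) (hΨ : IsSchwartzFock Ψ) :
    fockInner m Φ (secondQuant m s Ψ) = ∫ x, fockInner m (annX m x Φ) (annXMul m s x Ψ) := by
  obtain ⟨N, hN⟩ := hΨ.finite
  have hannX := integral_fockInner (G := fun x => annX m x Φ)
    (fun x k hk => annXMul_eq_zero m s x (hN _ (Nat.lt_succ_of_le hk)))
    (integrable_fockWeight_mul_conj_annX_mul_annXMul hm hs hΦ hΨ)
  rw [fockInner_secondQuant hm hs hΦ hΨ, integral_fockInner_ann hm hs hΦ hΨ hN, hannX]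
  simp only [integral_fockWeight_mul_conj_annX_mul_annXMul hm hs hΦ hΨ]

end CoordinateSpace

section VelocityConvolution

variable {n : ℕ} {m : ℝ} {Ψ : WaveSeq n}

theorem neg_I_mul_sineTransform_velKernel (hm : 0 < m) (j : Fin n) (p : Vec n) :
    -Complex.I * (sineTransform (velKernel m j) p : ℂ) = Complex.I * velocity m j p := by
  rw [sineTransform, integral_velKernel_mul_sin hm, velocity, lowerIdx, neg_div, Complex.ofReal_neg,
    neg_mul_comm]

theorem integrableOn_velConvIntegrand (hm : 0 < m) (j : Fin n) (hΨ : IsSchwartzFock Ψ) (x : Vec n)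
    (k : ℕ) (q : Fin k → Vec n) {ε : ℝ} (hε : 0 < ε) :
    IntegrableOn (velConvIntegrand m j Ψ x k q) {y : Vec n | ε < ‖x - y‖} := by
  obtain ⟨f, hf⟩ := exists_schwartz_ann hm hΨ k q
  have hann : (fun p => ann m p Ψ k q) = f := funext fun p => (hf p).symm
  unfold velConvIntegrand
  simpa only [annX_apply, hann] using
    integrableOn_sub_mul_unitaryFourierInv (integrable_norm_mul_velKernel hm j) hε f.integrable x

theorem tendsto_velConvTrunc (hm : 0 < m) (j : Fin n) (hΨ : IsSchwartzFock Ψ) (x : Vec n)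
    (k : ℕ) (q : Fin k → Vec n) :
    Tendsto (fun ε => velConvTrunc m j ε x Ψ k q) (𝓝[>] 0)
      (𝓝 (Complex.I * annXMul m (velocity m j) x Ψ k q)) := by
  obtain ⟨f, hf⟩ := exists_schwartz_ann hm hΨ k q
  have hann : (fun p => ann m p Ψ k q) = f := funext fun p => (hf p).symm
  have hpf : Integrable fun p => ‖p‖ * ‖f p‖ := by
    simpa only [pow_one] using f.integrable_pow_mul (μ := volume) 1
  have hlim := tendsto_setIntegral_sub_mul_unitaryFourierInv (odd_velKernel m j)
    (integrable_norm_mul_velKernel hm j) f.integrable hpf x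
  simpa only [velConvTrunc, velConvIntegrand, annX_apply, annXMul, hann, hf, mul_assoc,
    neg_I_mul_sineTransform_velKernel hm, unitaryFourierInv_const_mul] using hlim

theorem velConv_eq_I_smul_annXMul (hm : 0 < m) (j : Fin n) (hΨ : IsSchwartzFock Ψ) (x : Vec n) :
    velConv m j x Ψ = Complex.I • annXMul m (velocity m j) x Ψ := by
  funext k q
  exact (tendsto_velConvTrunc hm j hΨ x k q).limUnder_eq

end VelocityConvolution

theorem mainTheorem6 (n : ℕ) (m : ℝ) (hm : 0 < m) (j : Fin n) :
    -- the convolution integral exists as a principal value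
    (∀ Ψ : WaveSeq n, IsSchwartzFock Ψ → ∀ (x : Vec n) (k : ℕ) (q : Fin k → Vec n),
      (∀ ε : ℝ, 0 < ε →
        IntegrableOn (velConvIntegrand m j Ψ x k q) {y : Vec n | ε < ‖x - y‖}) ∧
      Tendsto (fun ε => velConvTrunc m j ε x Ψ k q) (𝓝[>] (0 : ℝ)) (𝓝 (velConv m j x Ψ k q))) ∧
    -- the velocity operator in coordinate space, as an operator
    (∀ Ψ : WaveSeq n, IsSchwartzFock Ψ →
      (∀ (k : ℕ) (q : Fin k → Vec n), Integrable fun x : Vec n => velConv m j x Ψ k q) ∧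
      opV m j Ψ = (-Complex.I) • creIntX m fun x => velConv m j x Ψ) ∧
    -- the velocity operator in momentum and in coordinate space, as a form
    (∀ Φ Ψ : WaveSeq n, IsSchwartzFock Φ → IsSchwartzFock Ψ →
      Integrable (fun p : Vec n =>
        ((lowerIdx p j / energy m p : ℝ) : ℂ) * fockInner m (ann m p Φ) (ann m p Ψ)) ∧
      fockInner m Φ (opV m j Ψ) = ∫ p : Vec n,
        ((lowerIdx p j / energy m p : ℝ) : ℂ) * fockInner m (ann m p Φ) (ann m p Ψ) ∧
      Integrable (fun x : Vec n => fockInner m (annX m x Φ) (velConv m j x Ψ)) ∧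
      fockInner m Φ (opV m j Ψ) =
        -Complex.I * ∫ x : Vec n, fockInner m (annX m x Φ) (velConv m j x Ψ)) ∧
    -- the Heisenberg equation
    (∀ Ψ : WaveSeq n, IsSchwartzFock Ψ →
      opP0 m (opX m j Ψ) - opX m j (opP0 m Ψ) = (-Complex.I) • opV m j Ψ) := by
  have hvel := hasTemperateGrowth_velocity hm j
  have hconv (Ψ : WaveSeq n) (hΨ : IsSchwartzFock Ψ) (x : Vec n) :
      velConv m j x Ψ = Complex.I • annXMul m (velocity m j) x Ψ :=
    velConv_eq_I_smul_annXMul hm j hΨ x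
  refine ⟨fun Ψ hΨ x k q => ⟨fun ε hε => integrableOn_velConvIntegrand hm j hΨ x k q hε, ?_⟩,
    fun Ψ hΨ => ⟨fun k q => ?_, ?_⟩, fun Φ Ψ hΦ hΨ => ⟨?_, ?_, ?_, ?_⟩,
    fun Ψ hΨ => opP0_opX_sub_opX_opP0 hm j hΨ⟩
  · rw [hconv Ψ hΨ]
    exact tendsto_velConvTrunc hm j hΨ x k q
  · simp only [hconv Ψ hΨ]
    exact (integrable_annXMul hm hvel hΨ k q).const_mul Complex.I
  · simp only [hconv Ψ hΨ, creIntX_const_smul, creIntX_annXMul hm hvel hΨ, smul_smul, neg_mul,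
      Complex.I_mul_I, neg_neg, one_smul, opV_eq_secondQuant]
  · simpa only [fockInner_smul_right, velocity] using integrable_fockInner_ann hm hvel hΦ hΨ
  · simpa only [fockInner_smul_right, velocity, opV_eq_secondQuant] using
      fockInner_secondQuant hm hvel hΦ hΨ
  · simpa only [hconv Ψ hΨ, fockInner_smul_right] using
      (integrable_fockInner_annX_annXMul hm hvel hΦ hΨ).const_mul Complex.I
  · simp only [hconv Ψ hΨ, fockInner_smul_right, integral_const_mul, ← mul_assoc, neg_mul,
      Complex.I_mul_I, neg_neg, one_mul, opV_eq_secondQuant]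
    exact fockInner_secondQuant_eq_integral_annX hm hvel hΦ hΨ
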